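/- For an open set $\Omega\subset\mathbb{C}^n$ let $A^2(\Omega)$ be the space of square-integrable holomorphic functions on $\Omega$ (Lebesgue measure $dV$) and let $K_\Omega(z,w)$ be its reproducing kernel, the Bergman kernel: $K_\Omega(\cdot,w)\in A^2(\Omega)$ and $f(w)=\int_\Omega f(z)\overline{K_\Omega(z,w)}\,dV(z)$ for all $f\in A^2(\Omega)$, $w\in\Omega$. A domain $\Omega$ satisfies property BR if $K_\Omega(z,z)\neq 0$ for all $z\in\Omega$ and $$\sup\Big\{\frac{|K_\Omega(w,z)|}{K_\Omega(z,z)}: z,w\in\Omega\Big\}<\infty .$$ The absolute Bergman projection is $P^+_\Omega f(z)=\int_\Omega |K_\Omega(z,w)|f(w)\,dV(w)$; boundedness on $L^p(\Omega)$ means that for each $f\in L^p(\Omega)$ the integral converges absolutely for almost every $z$ and defines a bounded operator on $L^p(\Omega)$, whose operator norm is written $\|P^+_\Omega\|_{L^p}$. **Sharp $\mathcal{B}$-type.** The Bergman kernel of a bounded domain $\Omega\subset\mathbb{C}^n$ with smooth boundary is of sharp $\mathcal{B}$-type if, for some smooth defining function $r:\mathbb{C}^n\to\mathbb{R}$ ($\Omega=\{r<0\}$,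 $dr\ne0$ on $b\Omega$): 1. for every $\varepsilon>0$, $K_\Omega(z,w)$ is bounded on $\{(z,w)\in\Omega\times\Omega: |z-w|+|r(z)|\ge\varepsilon\}$; 2. every $p\in b\Omega$ has an open neighbourhood $U$ for which there are constants $\delta_0,R>0$, $C\ge1$ and, for each $z\in U\cap\Omega$ and $0<\delta\le\delta_0$: - numbers $b_1(z,\delta)=1/\delta$ and $b_j(z,\delta)>0$, $2\le j\le n$, with $b_j(z,\delta)\le C\delta^{-1/2}$ and $C^{-1}b_j(z,\delta)\le b_j(z,\delta')\le C(\delta/\delta')^{1/2}b_j(z,\delta)$ for $0<\delta'\le\delta$; - holomorphic coordinates centred at $z$, given by a holomorphic map $\Psi_{z,\delta}$ on the ball $\{|\zeta|<R\}$ with $\Psi_{z,\delta}(0)=z$ and image containing $U$, such that $C^{-1}|\zeta-\xi|\le|\Psi_{z,\delta}(\zeta)-\Psi_{z,\delta}(\xi)|\le C|\zeta-\xi|$ and $|\partial (r\circ\Psi_{z,\delta})/\partial \mathrm{Re}\,\zeta_1|\ge 1/C$ on this ball; such that, with the polydiscs $P_\delta(z)=\Psi_{z,\delta}\big(\{|\zeta|<R,\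 |\zeta_j|<1/b_j(z,\delta)\ \forall j\}\big)$, there are constants $A,c>0$ with $$|K_\Omega(z,w)|\le A\prod_{j=1}^n b_j(z,\delta)^2\qquad\text{for } z,w\in U\cap\Omega \text{ and } 0<\delta\le\delta_0 \text{ with } \delta\le|r(z)|+|r(w)| \text{ or } w\notin P_\delta(z),$$ $$K_\Omega(z,z)\ge c\prod_{j=1}^n b_j(z,|r(z)|)^2\qquad\text{for } z\in U\cap\Omega \text{ with } |r(z)|\le\delta_0 .$$ **Corollary.** Let $\Omega=\Omega_1\times\cdots\times\Omega_m$ be a product domain such that each $\Omega_j\subset\mathbb{C}^{n_j}$ is a bounded domain whose Bergman kernel is of sharp $\mathcal{B}$-type. Then (i) $\Omega$ satisfies property BR; (ii) for all $1<p<\infty$ the absolute Bergman projections $P^+_\Omega$ and $P^+_{\Omega_j}$ are bounded on $L^p(\Omega)$ and $L^p(\Omega_j)$ respectively, and $$\|P^+_{\Omega}\|_{L^p}=\|P^+_{\Omega_1}\|_{L^p(\Omega_1)}\cdots\|P^+_{\Omega_m}\|_{L^p(\Omega_m)} .$$ -/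

import Mathlib

open MeasureTheory Set Metric
open scoped ENNReal ContDiff

noncomputable section

/-- A domain: a nonempty connected open set. -/
def IsDomainSet {E : Type*} [TopologicalSpace E] (Ω : Set E) : Prop :=
  IsOpen Ω ∧ IsConnected Ω

/-! ### The Bergman kernel

The ambient space `E` is `ℂⁿ` or a finite product `ℂ^{n₁} × ⋯ × ℂ^{nₘ}`, with Lebesgue measure. -/

section Kernel

variable {E : Type*} [NormedAddCommGroup E] [NormedSpace ℂ E] [MeasureSpace E]

/-- `f` lies in the Bergman space `A²(Ω)`. -/
def MemBergman (Ω : Set E) (f : E → ℂ) : Prop :=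
  DifferentiableOn ℂ f Ω ∧ MemLp f 2 (volume.restrict Ω)

/-- `K` is the reproducing kernel of `A²(Ω)`: for `w ∈ Ω`, `K(·, w) ∈ A²(Ω)` and
`f(w) = ⟨f, K(·, w)⟩` for all `f ∈ A²(Ω)`. This determines `K` on `Ω × Ω`. -/
def IsBergmanKernel (Ω : Set E) (K : E → E → ℂ) : Prop :=
  ∀ w ∈ Ω, MemBergman Ω (fun z => K z w) ∧
    ∀ f : E → ℂ, MemBergman Ω f → f w = ∫ z in Ω, f z * (starRingEnd ℂ) (K z w)

open Classical in
/-- The Bergman kernel `K_Ω(z, w)` (it exists for every open subset of `ℂⁿ`; the values off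
`Ω × Ω` are irrelevant). -/
def bergmanKernel (Ω : Set E) : E → E → ℂ :=
  if h : ∃ K, IsBergmanKernel Ω K then h.choose else 0

/-- Property BR: `K_Ω(z,z) ≠ 0` on `Ω` and `|K_Ω(w,z)| / K_Ω(z,z)` is bounded on `Ω × Ω`
(recall that `K_Ω(z,z) ≥ 0`). -/
def PropertyBR (Ω : Set E) : Prop :=
  (∀ z ∈ Ω, bergmanKernel Ω z z ≠ 0) ∧
    BddAbove {x : ℝ | ∃ z ∈ Ω, ∃ w ∈ Ω, x = ‖bergmanKernel Ω w z‖ / ‖bergmanKernel Ω z z‖}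

/-- The bounded operator `T` on `L^p(Ω)` is the absolute Bergman projection: for `f ∈ L^p(Ω)` and
almost every `z ∈ Ω`, the integral `∫_Ω |K_Ω(z,w)| f(w) dV(w)` converges absolutely
and equals `(T f)(z)`. Such a `T` is unique. -/
def IsAbsBergmanProjection (Ω : Set E) (p : ℝ≥0∞) [Fact (1 ≤ p)]
    (T : Lp ℂ p (volume.restrict Ω) →L[ℂ] Lp ℂ p (volume.restrict Ω)) : Prop :=
  ∀ f : Lp ℂ p (volume.restrict Ω), ∀ᵐ z ∂(volume.restrict Ω),
    Integrable (fun w => (‖bergmanKernel Ω z w‖ : ℂ) * f w) (volume.restrict Ω) ∧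
      T f z = ∫ w in Ω, (‖bergmanKernel Ω z w‖ : ℂ) * f w

end Kernel

/-! ### Bergman kernels of sharp `𝓑`-type -/

section BType

variable {n : ℕ}

/-- `r` is a smooth defining function of `Ω ⊆ ℂⁿ`. -/
def IsDefiningFunction (Ω : Set (EuclideanSpace ℂ (Fin n)))
    (r : EuclideanSpace ℂ (Fin n) → ℝ) : Prop :=
  ContDiff ℝ ∞ r ∧ Ω = {z | r z < 0} ∧ ∀ z ∈ frontier Ω, fderiv ℝ r z ≠ 0

/-- A `𝓑`-system near the boundary point `p`: on a neighbourhood `U` of `p`, for every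
`z ∈ U ∩ Ω` and every scale `0 < δ ≤ δ₀`,
* inverse radii `b_j(z,δ) > 0`, with `b_ν(z,δ) = 1/δ` for the index `ν` of the complex normal
  direction (`ν = 1` in the usual numbering), `b_j(z,δ) ≲ δ^{-1/2}` for `j ≠ ν`, and
  `b_j(z,δ) ≲ b_j(z,δ') ≲ (δ/δ')^{1/2} b_j(z,δ)` for `δ' ≤ δ` and `j ≠ ν`;
* holomorphic coordinates `ζ` centred at `z`, given by the map `w = Ψ(z,δ)(ζ)`, `|ζ| < R`,
  covering `U`, uniformly bi-Lipschitz, with the real direction of `ζ_ν` uniformly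
  transverse to the level sets of `r`.
All constants are uniform in `z` and `δ`. -/
structure BSystem (Ω : Set (EuclideanSpace ℂ (Fin n))) (r : EuclideanSpace ℂ (Fin n) → ℝ)
    (p : EuclideanSpace ℂ (Fin n)) where
  U : Set (EuclideanSpace ℂ (Fin n))
  isOpen_U : IsOpen U
  mem_U : p ∈ U
  δ₀ : ℝ
  δ₀_pos : 0 < δ₀
  R : ℝ
  R_pos : 0 < R
  C : ℝ
  one_le_C : 1 ≤ C
  ν : Fin n
  b : Fin n → EuclideanSpace ℂ (Fin n) → ℝ → ℝ
  Ψ : EuclideanSpace ℂ (Fin n) → ℝ → EuclideanSpace ℂ (Fin n) → EuclideanSpace ℂ (Fin n)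
  b_pos : ∀ z ∈ U ∩ Ω, ∀ δ ∈ Ioc 0 δ₀, ∀ j, 0 < b j z δ
  b_normal : ∀ z ∈ U ∩ Ω, ∀ δ ∈ Ioc 0 δ₀, b ν z δ = 1 / δ
  b_le : ∀ z ∈ U ∩ Ω, ∀ δ ∈ Ioc 0 δ₀, ∀ j, j ≠ ν → b j z δ ≤ C / √δ
  b_anti : ∀ z ∈ U ∩ Ω, ∀ δ ∈ Ioc 0 δ₀, ∀ δ' ∈ Ioc 0 δ, ∀ j, j ≠ ν → b j z δ ≤ C * b j z δ'
  b_scale : ∀ z ∈ U ∩ Ω, ∀ δ ∈ Ioc 0 δ₀, ∀ δ' ∈ Ioc 0 δ, ∀ j, j ≠ ν →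
    b j z δ' ≤ C * √(δ / δ') * b j z δ
  Ψ_center : ∀ z ∈ U ∩ Ω, ∀ δ ∈ Ioc 0 δ₀, Ψ z δ 0 = z
  Ψ_holomorphic : ∀ z ∈ U ∩ Ω, ∀ δ ∈ Ioc 0 δ₀, DifferentiableOn ℂ (Ψ z δ) (ball 0 R)
  Ψ_biLipschitz : ∀ z ∈ U ∩ Ω, ∀ δ ∈ Ioc 0 δ₀, ∀ ζ ∈ ball 0 R, ∀ ξ ∈ ball 0 R,
    dist (Ψ z δ ζ) (Ψ z δ ξ) ≤ C * dist ζ ξ ∧ dist ζ ξ ≤ C * dist (Ψ z δ ζ) (Ψ z δ ξ)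
  Ψ_cover : ∀ z ∈ U ∩ Ω, ∀ δ ∈ Ioc 0 δ₀, U ⊆ Ψ z δ '' ball 0 R
  transverse : ∀ z ∈ U ∩ Ω, ∀ δ ∈ Ioc 0 δ₀, ∀ ζ ∈ ball 0 R,
    1 / C ≤ |fderiv ℝ (fun ξ => r (Ψ z δ ξ)) ζ (EuclideanSpace.single ν 1)|

/-- The polydisc `P_δ(z) = {w : |ζ_j| < 1 / b_j(z,δ) for all j}`, where `w = Ψ(z,δ)(ζ)`. -/
def BSystem.polydisc {Ω : Set (EuclideanSpace ℂ (Fin n))} {r : EuclideanSpace ℂ (Fin n) → ℝ}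
    {p : EuclideanSpace ℂ (Fin n)} (B : BSystem Ω r p) (z : EuclideanSpace ℂ (Fin n)) (δ : ℝ) :
    Set (EuclideanSpace ℂ (Fin n)) :=
  B.Ψ z δ '' {ζ | ζ ∈ ball 0 B.R ∧ ∀ j, ‖ζ j‖ < 1 / B.b j z δ}

/-- The size estimate `|K_Ω(z,w)| ≲ ∏_j b_j(z, δ(z,w))²` on `U ∩ Ω`, where
`δ(z,w) = |r(z)| + |r(w)| + inf {δ : w ∈ P_δ(z)}`: the bound by `∏_j b_j(z,δ)²` holds for every
`δ ≤ δ₀` that is at most `|r(z)| + |r(w)|` or for which `w ∉ P_δ(z)`. -/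
def BSystem.UpperEstimate {Ω : Set (EuclideanSpace ℂ (Fin n))}
    {r : EuclideanSpace ℂ (Fin n) → ℝ} {p : EuclideanSpace ℂ (Fin n)} (B : BSystem Ω r p) : Prop :=
  ∃ A : ℝ, ∀ z ∈ B.U ∩ Ω, ∀ w ∈ B.U ∩ Ω, ∀ δ ∈ Ioc 0 B.δ₀,
    (δ ≤ |r z| + |r w| ∨ w ∉ B.polydisc z δ) →
      ‖bergmanKernel Ω z w‖ ≤ A * ∏ j, B.b j z δ ^ 2

/-- Sharpness on the diagonal: `K_Ω(z,z) ≳ ∏_j b_j(z,|r(z)|)²`. -/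
def BSystem.LowerEstimate {Ω : Set (EuclideanSpace ℂ (Fin n))}
    {r : EuclideanSpace ℂ (Fin n) → ℝ} {p : EuclideanSpace ℂ (Fin n)} (B : BSystem Ω r p) : Prop :=
  ∃ c : ℝ, 0 < c ∧ ∀ z ∈ B.U ∩ Ω, |r z| ≤ B.δ₀ →
    c * ∏ j, B.b j z |r z| ^ 2 ≤ ‖bergmanKernel Ω z z‖

/-- The Bergman kernel of the smoothly bounded set `Ω` is of sharp `𝓑`-type: it is bounded away
from the boundary diagonal, and near every boundary point it satisfies the size
estimate and the matching diagonal lower bound of some `𝓑`-system. -/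
def HasSharpBTypeKernel (Ω : Set (EuclideanSpace ℂ (Fin n))) : Prop :=
  ∃ r : EuclideanSpace ℂ (Fin n) → ℝ, IsDefiningFunction Ω r ∧
    (∀ ε : ℝ, 0 < ε → ∃ A : ℝ, ∀ z ∈ Ω, ∀ w ∈ Ω, ε ≤ dist z w + |r z| →
      ‖bergmanKernel Ω z w‖ ≤ A) ∧
    ∀ p ∈ frontier Ω, ∃ B : BSystem Ω r p, B.UpperEstimate ∧ B.LowerEstimate

end BType

end

/-!
The proof has two independent halves: an estimate on each factor, and a formal argument that
passes from the factors to the product.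

*One factor.* Let `r` be the defining function of a bounded domain with kernel of sharp `𝓑`-type.
Property BR is the comparison of the size estimate at scale `δ = |r(z)|` with the diagonal lower
bound, which have the same right-hand side; away from the boundary the kernel is bounded and
`K(z, z) ≥ 1 / vol Ω`. Compactness of the closure makes this uniform (`exists_kernel_le_diag`).

Boundedness of the absolute Bergman projection on `L^p` is Schur's test
(`posNorm_lt_top_of_schur`) with a power of `|r|` as weight. It rests on
`∫_Ω |K(z, w)| |r(w)|^{-a} dV(w) ≲ |r(z)|^{-a}` for `0 < a < 1`
(`exists_lintegral_kernel_le_global`). Near the boundary the integral is split into dyadic shells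
`P_{2^{k+1}ρ}(z) ∖ P_{2^k ρ}(z)`, `ρ = |r(z)|`. On such a shell `|K(z, ·)|` is at most a constant
times the reciprocal of the volume of the polydisc, and the mean of `|r|^{-a}` over the polydisc is
`≲ (2^k ρ)^{-a}` (`BSystem.exists_lintegral_image_ballPolydisc_le`), so the shells contribute a
geometric series. The mean value estimate comes from one real variable: along the real
direction of `ζ_ν` the function `r ∘ Ψ` has derivative bounded below in modulus, hence is expanding,
hence is bounded below by the distance to a fixed point of the line
(`exists_abs_sub_le_of_expanding`); averaging over translations in that direction replaces
Fubini's theorem in coordinates (`lintegral_le_of_lintegral_segment_le`).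

*The product.* The Bergman kernel of a product is the product of the kernels
(`IsBergmanKernel.pi`), which gives property BR at once. Since the kernels of the absolute
projections are nonnegative, their `L^p` norms are computed on nonnegative functions
(`enorm_rpow_eq_posNorm`). For these, Tonelli's theorem factors the product operator into
operators in each variable, whence `≤`, and testing on products `f(x) g(y)` gives `≥`
(`posNorm_tensorKernel`, `posNorm_pi`).
-/

open MeasureTheory Set Metric
open scoped ENNReal ContDiff

noncomputable section

/-! ### Integral operators with positive kernels -/

section PositiveKernel

variable {X Y : Type*} [MeasurableSpace X] [MeasurableSpace Y]

/-- The integral operator with kernel `k`, acting on `[0, ∞]`-valued functions. -/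
def posIntegral (μ : Measure X) (k : X → X → ℝ≥0∞) (f : X → ℝ≥0∞) (x : X) : ℝ≥0∞ :=
  ∫⁻ y, k x y * f y ∂μ

/-- The `p`-th power of the operator norm on `L^p(μ)` of the integral operator with the positive
kernel `k`, tested on nonnegative functions. -/
def posNorm (μ : Measure X) (k : X → X → ℝ≥0∞) (p : ℝ) : ℝ≥0∞ :=
  ⨆ (f : X → ℝ≥0∞) (_ : Measurable f) (_ : ∫⁻ x, f x ^ p ∂μ ≤ 1),
    ∫⁻ x, posIntegral μ k f x ^ p ∂μ

/-- The kernel `k(x, x') l(y, y')` on a product space. -/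
def tensorKernel (k : X → X → ℝ≥0∞) (l : Y → Y → ℝ≥0∞) (a b : X × Y) : ℝ≥0∞ :=
  k a.1 b.1 * l a.2 b.2

theorem measurable_posIntegral {μ : Measure X} [SFinite μ] {k : X → X → ℝ≥0∞}
    (hk : Measurable (Function.uncurry k)) {f : X → ℝ≥0∞} (hf : Measurable f) :
    Measurable (posIntegral μ k f) :=
  Measurable.lintegral_prod_right' (f := fun a : X × X => k a.1 a.2 * f a.2)
    (hk.mul (hf.comp measurable_snd))

theorem measurable_tensorKernel {k : X → X → ℝ≥0∞} {l : Y → Y → ℝ≥0∞}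
    (hk : Measurable (Function.uncurry k)) (hl : Measurable (Function.uncurry l)) :
    Measurable (Function.uncurry (tensorKernel k l)) :=
  (hk.comp ((measurable_fst.comp measurable_fst).prodMk (measurable_fst.comp measurable_snd))).mul
    (hl.comp ((measurable_snd.comp measurable_fst).prodMk (measurable_snd.comp measurable_snd)))

theorem posNorm_le {μ : Measure X} {k : X → X → ℝ≥0∞} {p : ℝ} {C : ℝ≥0∞}
    (h : ∀ f : X → ℝ≥0∞, Measurable f → ∫⁻ x, f x ^ p ∂μ ≤ 1 →
      ∫⁻ x, posIntegral μ k f x ^ p ∂μ ≤ C) : posNorm μ k p ≤ C :=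
  iSup_le fun f => iSup_le fun hf => iSup_le fun h1 => h f hf h1

theorem le_posNorm {μ : Measure X} {k : X → X → ℝ≥0∞} {p : ℝ} {f : X → ℝ≥0∞}
    (hf : Measurable f) (h1 : ∫⁻ x, f x ^ p ∂μ ≤ 1) :
    ∫⁻ x, posIntegral μ k f x ^ p ∂μ ≤ posNorm μ k p :=
  le_iSup_of_le f (le_iSup_of_le hf (le_iSup_of_le h1 le_rfl))

theorem posIntegral_const_mul {μ : Measure X} {k : X → X → ℝ≥0∞}
    (hk : Measurable (Function.uncurry k)) {f : X → ℝ≥0∞} (hf : Measurable f) (c : ℝ≥0∞) (x : X) :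
    posIntegral μ k (fun y => c * f y) x = c * posIntegral μ k f x := by
  unfold posIntegral
  have hm : Measurable fun y => k x y * f y := (hk.of_uncurry_left (x := x)).mul hf
  rw [← lintegral_const_mul _ hm]
  exact lintegral_congr fun y => by ring

theorem lintegral_posIntegral_rpow_le {μ : Measure X} [SFinite μ] {k : X → X → ℝ≥0∞}
    (hk : Measurable (Function.uncurry k)) {p : ℝ} (hp : 0 < p) {f : X → ℝ≥0∞}
    (hf : Measurable f) (hfin : ∫⁻ x, f x ^ p ∂μ ≠ ⊤) :
    ∫⁻ x, posIntegral μ k f x ^ p ∂μ ≤ posNorm μ k p * ∫⁻ x, f x ^ p ∂μ := by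
  set s := ∫⁻ x, f x ^ p ∂μ with hs
  rcases eq_or_ne s 0 with h0 | h0
  · have hf0 : f =ᵐ[μ] 0 := by
      have := (lintegral_eq_zero_iff (hf.pow_const p)).1 (hs ▸ h0)
      filter_upwards [this] with x hx
      simpa [hp.le, hp.not_gt, hp] using hx
    have : ∀ x, posIntegral μ k f x = 0 := by
      intro x
      unfold posIntegral
      rw [lintegral_congr_ae (g := fun _ => 0)]
      · simp
      · filter_upwards [hf0] with y hy
        simp [hy]
    simp [this, hp]
  · set c := (s⁻¹) ^ (p⁻¹) with hc
    have hcp : c ^ p = s⁻¹ := by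
      rw [hc, ← ENNReal.rpow_mul, inv_mul_cancel₀ hp.ne', ENNReal.rpow_one]
    have key := le_posNorm (μ := μ) (k := k) (p := p) (f := fun y => c * f y) (hf.const_mul c) (by
      simp_rw [ENNReal.mul_rpow_of_nonneg _ _ hp.le, hcp]
      rw [lintegral_const_mul _ (hf.pow_const p), ← hs, ENNReal.inv_mul_cancel h0 hfin])
    simp_rw [posIntegral_const_mul hk hf, ENNReal.mul_rpow_of_nonneg _ _ hp.le, hcp] at key
    rw [lintegral_const_mul _ ((measurable_posIntegral hk hf).pow_const p)] at key
    rw [mul_comm]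
    have := mul_le_mul_right key s
    rwa [← mul_assoc, ENNReal.mul_inv_cancel h0 hfin, one_mul] at this

/-- The tensor product operator factors through an operator in each variable (Tonelli). -/
theorem posIntegral_tensorKernel {μ : Measure X} {ν : Measure Y} [SFinite μ] [SFinite ν]
    {k : X → X → ℝ≥0∞} {l : Y → Y → ℝ≥0∞} (hk : Measurable (Function.uncurry k))
    (hl : Measurable (Function.uncurry l)) {f : X × Y → ℝ≥0∞} (hf : Measurable f) (a : X × Y) :
    posIntegral (μ.prod ν) (tensorKernel k l) f a =
      posIntegral μ k (fun x => posIntegral ν l (fun y => f (x, y)) a.2) a.1 := by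
  unfold posIntegral
  have hm : Measurable fun b => tensorKernel k l a b * f b :=
    ((measurable_tensorKernel hk hl).of_uncurry_left (x := a)).mul hf
  rw [lintegral_prod _ hm.aemeasurable]
  refine lintegral_congr fun x => ?_
  have hm' : Measurable fun y => l a.2 y * f (x, y) :=
    (hl.of_uncurry_left (x := a.2)).mul (hf.comp measurable_prodMk_left)
  rw [← lintegral_const_mul _ hm']
  exact lintegral_congr fun y => by simp [tensorKernel, mul_assoc]

/-- The norm is multiplicative. For `≤`, the finiteness of the norm of `l` ensures that after `l` has
acted in the second variable almost every slice in the first variable is still in `L^p`. -/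
theorem posNorm_tensorKernel {μ : Measure X} {ν : Measure Y} [SFinite μ] [SFinite ν]
    {k : X → X → ℝ≥0∞} {l : Y → Y → ℝ≥0∞} (hk : Measurable (Function.uncurry k))
    (hl : Measurable (Function.uncurry l)) {p : ℝ} (hp : 0 < p)
    (hlfin : posNorm ν l p ≠ ⊤) :
    posNorm (μ.prod ν) (tensorKernel k l) p = posNorm μ k p * posNorm ν l p := by
  apply le_antisymm
  · refine posNorm_le fun f hf h1 => ?_
    have hG : Measurable fun a : X × Y => posIntegral ν l (fun y => f (a.1, y)) a.2 :=
      Measurable.lintegral_prod_right'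
        (f := fun b : (X × Y) × Y => l b.1.2 b.2 * f (b.1.1, b.2))
        ((hl.comp ((measurable_snd.comp measurable_fst).prodMk measurable_snd)).mul
          (hf.comp ((measurable_fst.comp measurable_fst).prodMk measurable_snd)))
    have h1' : ∫⁻ x, ∫⁻ y, f (x, y) ^ p ∂ν ∂μ ≤ 1 := by
      rwa [← lintegral_prod _ (hf.pow_const p).aemeasurable]
    have hm : Measurable fun x => ∫⁻ y, f (x, y) ^ p ∂ν :=
      Measurable.lintegral_prod_right' (hf.pow_const p)
    have hGle : ∫⁻ a, posIntegral ν l (fun y => f (a.1, y)) a.2 ^ p ∂(μ.prod ν)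
        ≤ posNorm ν l p := by
      rw [lintegral_prod _ (hG.pow_const p).aemeasurable]
      calc ∫⁻ x, ∫⁻ y, posIntegral ν l (fun y' => f (x, y')) y ^ p ∂ν ∂μ
          ≤ ∫⁻ x, posNorm ν l p * ∫⁻ y, f (x, y) ^ p ∂ν ∂μ := by
            refine lintegral_mono_ae ?_
            filter_upwards [ae_lt_top hm (h1'.trans_lt ENNReal.one_lt_top).ne] with x hx
            exact lintegral_posIntegral_rpow_le hl hp (hf.comp measurable_prodMk_left) hx.ne
        _ = posNorm ν l p * ∫⁻ x, ∫⁻ y, f (x, y) ^ p ∂ν ∂μ := lintegral_const_mul _ hm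
        _ ≤ posNorm ν l p * 1 := by gcongr
        _ = posNorm ν l p := mul_one _
    have hm2 : Measurable fun y => ∫⁻ x, posIntegral ν l (fun y' => f (x, y')) y ^ p ∂μ :=
      Measurable.lintegral_prod_left' (f := fun a : X × Y =>
        posIntegral ν l (fun y => f (a.1, y)) a.2 ^ p) (hG.pow_const p)
    have hGle' : ∫⁻ y, ∫⁻ x, posIntegral ν l (fun y' => f (x, y')) y ^ p ∂μ ∂ν
        ≤ posNorm ν l p := by
      rwa [← lintegral_prod_symm' (fun a : X × Y =>
        posIntegral ν l (fun y => f (a.1, y)) a.2 ^ p) (hG.pow_const p)]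
    rw [lintegral_prod_symm' _ ((measurable_posIntegral (measurable_tensorKernel hk hl)
      hf).pow_const p)]
    simp_rw [posIntegral_tensorKernel hk hl hf]
    calc ∫⁻ y, ∫⁻ x, posIntegral μ k
            (fun x' => posIntegral ν l (fun y' => f (x', y')) y) x ^ p ∂μ ∂ν
        ≤ ∫⁻ y, posNorm μ k p * ∫⁻ x, posIntegral ν l (fun y' => f (x, y')) y ^ p ∂μ ∂ν := by
          refine lintegral_mono_ae ?_
          filter_upwards [ae_lt_top hm2 (hGle'.trans_lt hlfin.lt_top).ne] with y hy
          exact lintegral_posIntegral_rpow_le hk hp (hG.comp measurable_prodMk_right) hy.ne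
      _ = posNorm μ k p * ∫⁻ y, ∫⁻ x, posIntegral ν l (fun y' => f (x, y')) y ^ p ∂μ ∂ν :=
          lintegral_const_mul _ hm2
      _ ≤ posNorm μ k p * posNorm ν l p := by gcongr
  · -- Test the tensor product operator on the functions `f ⊗ g`.
    have key : ∀ f : X → ℝ≥0∞, Measurable f → ∫⁻ x, f x ^ p ∂μ ≤ 1 →
        ∀ g : Y → ℝ≥0∞, Measurable g → ∫⁻ y, g y ^ p ∂ν ≤ 1 →
        (∫⁻ x, posIntegral μ k f x ^ p ∂μ) * ∫⁻ y, posIntegral ν l g y ^ p ∂ν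
          ≤ posNorm (μ.prod ν) (tensorKernel k l) p := by
      intro f hf hf1 g hg hg1
      have hfg : Measurable fun a : X × Y => f a.1 * g a.2 :=
        (hf.comp measurable_fst).mul (hg.comp measurable_snd)
      have := le_posNorm (μ := μ.prod ν) (k := tensorKernel k l) (p := p) hfg (by
        simp_rw [ENNReal.mul_rpow_of_nonneg _ _ hp.le]
        rw [lintegral_prod_mul (hf.pow_const p).aemeasurable (hg.pow_const p).aemeasurable]
        exact mul_le_one' hf1 hg1)
      refine le_trans (le_of_eq ?_) this
      rw [← lintegral_prod_mul ((measurable_posIntegral hk hf).pow_const p).aemeasurable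
        ((measurable_posIntegral hl hg).pow_const p).aemeasurable]
      refine lintegral_congr fun a => ?_
      rw [← ENNReal.mul_rpow_of_nonneg _ _ hp.le, posIntegral_tensorKernel hk hl hfg]
      congr 1
      simp_rw [posIntegral_const_mul hl hg]
      rw [mul_comm, ← posIntegral_const_mul hk hf]
      congr 1
      funext x
      ring
    conv_lhs => unfold posNorm
    simp only [ENNReal.iSup_mul, ENNReal.mul_iSup]
    refine iSup_le fun f => iSup_le fun hf => iSup_le fun hf1 => iSup_le fun g => iSup_le fun hg =>
      iSup_le fun hg1 => ?_
    exact key _ ‹_› ‹_› _ ‹_› ‹_›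

/-- Invariance of the norm under measure preserving equivalences. -/
theorem posNorm_comp_measurableEquiv {μ : Measure X} {ν : Measure Y} (e : X ≃ᵐ Y)
    (he : MeasurePreserving e μ ν) (k : Y → Y → ℝ≥0∞) (p : ℝ) :
    posNorm μ (fun x x' => k (e x) (e x')) p = posNorm ν k p := by
  have hint : ∀ F : Y → ℝ≥0∞, ∫⁻ x, F (e x) ∂μ = ∫⁻ y, F y ∂ν :=
    fun F => he.lintegral_comp_emb e.measurableEmbedding F
  have hP : ∀ (f : Y → ℝ≥0∞) (x : X),
      posIntegral μ (fun x x' => k (e x) (e x')) (fun x => f (e x)) x = posIntegral ν k f (e x) :=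
    fun f x => hint fun y => k (e x) y * f y
  apply le_antisymm
  · refine posNorm_le fun f hf h1 => ?_
    have hff : (fun x => (f ∘ e.symm) (e x)) = f := by
      funext x
      simp
    have h2 := hint fun y => (f ∘ e.symm) y ^ p
    have h3 := hint fun y => posIntegral ν k (f ∘ e.symm) y ^ p
    simp_rw [← hP, hff] at h3
    rw [h3]
    refine le_posNorm (hf.comp e.symm.measurable) ?_
    rw [← h2]
    simpa using h1
  · refine posNorm_le fun f hf h1 => ?_
    rw [← hint]
    simp_rw [← hP]
    refine le_posNorm (hf.comp e.measurable) ?_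
    rwa [hint fun y => f y ^ p]

theorem measurable_prodKernel {m : ℕ} {Z : Fin m → Type*} [∀ i, MeasurableSpace (Z i)]
    {k : ∀ i, Z i → Z i → ℝ≥0∞} (hk : ∀ i, Measurable (Function.uncurry (k i))) :
    Measurable (Function.uncurry fun x y : ∀ i, Z i => ∏ i, k i (x i) (y i)) := by
  refine Finset.measurable_prod _ fun i _ => ?_
  exact (hk i).comp (((measurable_pi_apply i).comp measurable_fst).prodMk
    ((measurable_pi_apply i).comp measurable_snd))

/-- The norm of a product kernel on a finite product space is the product of the norms. -/
theorem posNorm_pi {m : ℕ} {Z : Fin m → Type*} [∀ i, MeasurableSpace (Z i)]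
    (μ : ∀ i, Measure (Z i)) [∀ i, SigmaFinite (μ i)] (k : ∀ i, Z i → Z i → ℝ≥0∞)
    (hk : ∀ i, Measurable (Function.uncurry (k i))) {p : ℝ} (hp : 0 < p)
    (hfin : ∀ i, posNorm (μ i) (k i) p ≠ ⊤) :
    posNorm (Measure.pi μ) (fun x y => ∏ i, k i (x i) (y i)) p = ∏ i, posNorm (μ i) (k i) p := by
  induction m with
  | zero =>
    have hdirac : Measure.pi μ = Measure.dirac (fun i => i.elim0) := Measure.pi_of_empty μ _
    simp only [Finset.univ_eq_empty, Finset.prod_empty]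
    rw [hdirac]
    apply le_antisymm
    · refine posNorm_le fun f hf h1 => ?_
      simpa [posIntegral, lintegral_dirac] using h1
    · refine le_trans (le_of_eq ?_) (le_posNorm (f := fun _ => 1) measurable_const (by simp))
      simp [posIntegral]
  | succ m ih =>
    have ih' := ih (fun i => μ i.succ) (fun i => k i.succ) (fun i => hk i.succ)
      (fun i => hfin i.succ)
    rw [Fin.prod_univ_succ, ← ih', ← posNorm_tensorKernel (hk 0)
      (measurable_prodKernel fun i => hk i.succ) hp
      (by rw [ih']; exact ENNReal.prod_ne_top fun i _ => hfin i.succ)]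
    refine Eq.trans ?_ (posNorm_comp_measurableEquiv (MeasurableEquiv.piFinSuccAbove Z 0)
        (measurePreserving_piFinSuccAbove μ 0) _ p)
    congr 1
    funext x y
    rw [Fin.prod_univ_succ]
    rfl

/-- Schur's test with weight `h`: a kernel that maps `h^q` and, transposed, `h^p` to at most constant
multiples of themselves is bounded on `L^p`. -/
theorem posNorm_lt_top_of_schur {μ : Measure X} [SFinite μ] {k : X → X → ℝ≥0∞}
    (hk : Measurable (Function.uncurry k)) {p q : ℝ} (hpq : p.HolderConjugate q)
    {h : X → ℝ≥0∞} (hh : Measurable h) (h0 : ∀ᵐ x ∂μ, h x ≠ 0) (htop : ∀ᵐ x ∂μ, h x ≠ ⊤)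
    {C : ℝ≥0∞} (hC : C ≠ ⊤)
    (h1 : ∀ᵐ x ∂μ, ∫⁻ y, k x y * h y ^ q ∂μ ≤ C * h x ^ q)
    (h2 : ∀ᵐ y ∂μ, ∫⁻ x, k x y * h x ^ p ∂μ ≤ C * h y ^ p) : posNorm μ k p < ⊤ := by
  have hp := hpq.pos
  have hq := hpq.symm.pos
  have hkx : ∀ x, Measurable (k x) := fun x => hk.of_uncurry_left
  have bound : posNorm μ k p ≤ C ^ (p / q) * C := by
    refine posNorm_le fun f hf hf1 => ?_
    have step : ∀ᵐ x ∂μ, posIntegral μ k f x ^ p ≤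
        C ^ (p / q) * ∫⁻ y, h x ^ p * (k x y * (f y ^ p * (h y ^ p)⁻¹)) ∂μ := by
      filter_upwards [h1] with x hx
      have holder := ENNReal.lintegral_mul_le_Lp_mul_Lq μ hpq
        (f := fun y => k x y ^ (1 / p) * (f y * (h y)⁻¹)) (g := fun y => k x y ^ (1 / q) * h y)
        (((hkx x).pow_const _).mul (hf.mul hh.inv)).aemeasurable
        (((hkx x).pow_const _).mul hh).aemeasurable
      have e1 : posIntegral μ k f x = ∫⁻ y, ((fun y => k x y ^ (1 / p) * (f y * (h y)⁻¹)) *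
          fun y => k x y ^ (1 / q) * h y) y ∂μ := by
        refine lintegral_congr_ae ?_
        filter_upwards [h0, htop] with y hy0 hyt
        simp only [Pi.mul_apply]
        have hk1 : k x y ^ (1 / p) * k x y ^ (1 / q) = k x y := by
          rw [← ENNReal.rpow_add_of_nonneg _ _ (by positivity) (by positivity), one_div, one_div,
            hpq.inv_add_inv_eq_one, ENNReal.rpow_one]
        calc k x y * f y = (k x y ^ (1 / p) * k x y ^ (1 / q)) * f y * ((h y)⁻¹ * h y) := by
              rw [hk1, ENNReal.inv_mul_cancel hy0 hyt, mul_one]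
          _ = _ := by ring
      have e2 : ∀ y, (k x y ^ (1 / p) * (f y * (h y)⁻¹)) ^ p = k x y * (f y ^ p * (h y ^ p)⁻¹) := by
        intro y
        rw [ENNReal.mul_rpow_of_nonneg _ _ hp.le, ENNReal.mul_rpow_of_nonneg _ _ hp.le,
          ← ENNReal.rpow_mul, one_div, inv_mul_cancel₀ hp.ne', ENNReal.rpow_one, ENNReal.inv_rpow]
      have e3 : ∀ y, (k x y ^ (1 / q) * h y) ^ q = k x y * h y ^ q := by
        intro y
        rw [ENNReal.mul_rpow_of_nonneg _ _ hq.le,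
          ← ENNReal.rpow_mul, one_div, inv_mul_cancel₀ hq.ne', ENNReal.rpow_one]
      rw [← e1] at holder
      simp_rw [e2, e3] at holder
      have hmeas : Measurable fun y => k x y * (f y ^ p * (h y ^ p)⁻¹) :=
        (hkx x).mul ((hf.pow_const p).mul (hh.pow_const p).inv)
      calc posIntegral μ k f x ^ p
          ≤ ((∫⁻ y, k x y * (f y ^ p * (h y ^ p)⁻¹) ∂μ) ^ (1 / p) *
              (C * h x ^ q) ^ (1 / q)) ^ p := by
            refine ENNReal.rpow_le_rpow (holder.trans ?_) hp.le
            gcongr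
        _ = C ^ (p / q) * (h x ^ p * ∫⁻ y, k x y * (f y ^ p * (h y ^ p)⁻¹) ∂μ) := by
            rw [ENNReal.mul_rpow_of_nonneg _ _ hp.le, ← ENNReal.rpow_mul, one_div,
              inv_mul_cancel₀ hp.ne', ENNReal.rpow_one,
              ENNReal.mul_rpow_of_nonneg _ _ (by positivity : 0 ≤ 1 / q), ← ENNReal.rpow_mul,
              mul_one_div_cancel hq.ne', ENNReal.rpow_one, ENNReal.mul_rpow_of_nonneg _ _ hp.le,
              ← ENNReal.rpow_mul, one_div_mul_eq_div]
            ring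
        _ = _ := by rw [lintegral_const_mul _ hmeas]
    have hmeas2 : Measurable fun a : X × X =>
        h a.1 ^ p * (k a.1 a.2 * (f a.2 ^ p * (h a.2 ^ p)⁻¹)) :=
      ((hh.comp measurable_fst).pow_const p).mul (hk.mul
        (((hf.comp measurable_snd).pow_const p).mul ((hh.comp measurable_snd).pow_const p).inv))
    calc ∫⁻ x, posIntegral μ k f x ^ p ∂μ
        ≤ ∫⁻ x, C ^ (p / q) * ∫⁻ y, h x ^ p * (k x y * (f y ^ p * (h y ^ p)⁻¹)) ∂μ ∂μ :=
          lintegral_mono_ae step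
      _ = C ^ (p / q) * ∫⁻ x, ∫⁻ y, h x ^ p * (k x y * (f y ^ p * (h y ^ p)⁻¹)) ∂μ ∂μ :=
          lintegral_const_mul _ hmeas2.lintegral_prod_right'
      _ = C ^ (p / q) * ∫⁻ y, ∫⁻ x, h x ^ p * (k x y * (f y ^ p * (h y ^ p)⁻¹)) ∂μ ∂μ := by
          rw [lintegral_lintegral_swap hmeas2.aemeasurable]
      _ ≤ C ^ (p / q) * ∫⁻ y, C * f y ^ p ∂μ := by
          refine mul_le_mul_right (lintegral_mono_ae ?_) _
          filter_upwards [h2, h0, htop] with y hy hy0 hyt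
          have hkm : Measurable fun x => k x y * h x ^ p :=
            (hk.of_uncurry_right (y := y)).mul (hh.pow_const p)
          calc ∫⁻ x, h x ^ p * (k x y * (f y ^ p * (h y ^ p)⁻¹)) ∂μ
              = ∫⁻ x, (f y ^ p * (h y ^ p)⁻¹) * (k x y * h x ^ p) ∂μ :=
                lintegral_congr fun x => by ring
            _ = (f y ^ p * (h y ^ p)⁻¹) * ∫⁻ x, k x y * h x ^ p ∂μ :=
                lintegral_const_mul _ hkm
            _ ≤ (f y ^ p * (h y ^ p)⁻¹) * (C * h y ^ p) := by gcongr
            _ = C * f y ^ p * ((h y ^ p)⁻¹ * h y ^ p) := by ring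
            _ = C * f y ^ p := by
                rw [ENNReal.inv_mul_cancel, mul_one]
                · simp [ENNReal.rpow_eq_zero_iff, hy0, hyt]
                · exact ENNReal.rpow_ne_top_of_nonneg hp.le hyt
      _ = C ^ (p / q) * (C * ∫⁻ y, f y ^ p ∂μ) := by
          rw [lintegral_const_mul _ (hf.pow_const p)]
      _ ≤ C ^ (p / q) * (C * 1) := by gcongr
      _ = C ^ (p / q) * C := by rw [mul_one]
  refine bound.trans_lt (ENNReal.mul_lt_top ?_ hC.lt_top)
  exact (ENNReal.rpow_ne_top_of_nonneg (by positivity) hC).lt_top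

end PositiveKernel

/-! ### The operator on complex `L^p` -/

section LpOperator

variable {X : Type*} [MeasurableSpace X] {μ : Measure X} {p : ℝ≥0∞}

theorem measurable_enorm_Lp (f : Lp ℂ p μ) : Measurable fun x => ‖f x‖ₑ :=
  (Lp.stronglyMeasurable f).measurable.enorm

variable [Fact (1 ≤ p)] {k : X → X → ℝ≥0∞} {K : X → X → ℂ}

/-- `T` is the integral operator on `L^p(μ)` with kernel `|K|`, the integrals being absolutely
convergent almost everywhere. -/
def IsAbsIntegralOperator (μ : Measure X) (K : X → X → ℂ) (p : ℝ≥0∞) [Fact (1 ≤ p)]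
    (T : Lp ℂ p μ →L[ℂ] Lp ℂ p μ) : Prop :=
  ∀ f : Lp ℂ p μ, ∀ᵐ z ∂μ, Integrable (fun w => (‖K z w‖ : ℂ) * f w) μ ∧
    T f z = ∫ w, (‖K z w‖ : ℂ) * f w ∂μ

theorem enorm_Lp_rpow (hp : p ≠ ⊤) (f : Lp ℂ p μ) :
    ‖f‖ₑ ^ p.toReal = ∫⁻ x, ‖f x‖ₑ ^ p.toReal ∂μ := by
  have h0 : p ≠ 0 := (lt_of_lt_of_le one_pos Fact.out).ne'
  rw [Lp.enorm_def, eLpNorm_eq_lintegral_rpow_enorm_toReal h0 hp, ← ENNReal.rpow_mul, one_div,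
    inv_mul_cancel₀ (ENNReal.toReal_pos h0 hp).ne', ENNReal.rpow_one]

theorem enorm_ofReal_norm (z : ℂ) : ‖(‖z‖ : ℂ)‖ₑ = ‖z‖ₑ := by
  rw [← ofReal_norm, ← ofReal_norm]
  simp

/-- For a nonnegative kernel, the norm on complex `L^p` is computed on nonnegative functions. -/
theorem enorm_rpow_eq_posNorm [SFinite μ] (hp : p ≠ ⊤) (hk : Measurable (Function.uncurry k))
    (hK : ∀ᵐ x ∂μ, ∀ᵐ y ∂μ, ‖K x y‖ₑ = k x y) (hfin : posNorm μ k p.toReal ≠ ⊤)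
    {T : Lp ℂ p μ →L[ℂ] Lp ℂ p μ} (hT : IsAbsIntegralOperator μ K p T) :
    ‖T‖ₑ ^ p.toReal = posNorm μ k p.toReal := by
  have h0 : p ≠ 0 := (lt_of_lt_of_le one_pos Fact.out).ne'
  have hp0 : 0 < p.toReal := ENNReal.toReal_pos h0 hp
  apply le_antisymm
  · -- `|T f| ≤ T |f|`
    rw [← ENNReal.le_rpow_inv_iff hp0]
    have hNt : posNorm μ k p.toReal ^ (p.toReal)⁻¹ ≠ ⊤ :=
      ENNReal.rpow_ne_top_of_nonneg (inv_nonneg.2 hp0.le) hfin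
    have hle : ‖T‖ ≤ (posNorm μ k p.toReal ^ (p.toReal)⁻¹).toReal := by
      refine T.opNorm_le_bound ENNReal.toReal_nonneg fun f => ?_
      have hf : ∫⁻ x, ‖f x‖ₑ ^ p.toReal ∂μ ≠ ⊤ := by
        rw [← enorm_Lp_rpow hp]
        exact ENNReal.rpow_ne_top_of_nonneg hp0.le enorm_ne_top
      have main : ‖T f‖ₑ ^ p.toReal ≤ posNorm μ k p.toReal * ‖f‖ₑ ^ p.toReal := by
        rw [enorm_Lp_rpow hp, enorm_Lp_rpow hp]
        refine le_trans (lintegral_mono_ae ?_)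
          (lintegral_posIntegral_rpow_le hk hp0 (measurable_enorm_Lp f) hf)
        filter_upwards [hT f, hK] with z hz hKz
        rw [hz.2]
        refine ENNReal.rpow_le_rpow ((enorm_integral_le_lintegral_enorm _).trans
          (le_of_eq (lintegral_congr_ae ?_))) hp0.le
        filter_upwards [hKz] with w hw
        rw [enorm_mul, enorm_ofReal_norm, hw]
      rw [← ENNReal.le_rpow_inv_iff hp0,
        ENNReal.mul_rpow_of_nonneg _ _ (inv_nonneg.2 hp0.le), ← ENNReal.rpow_mul,
        mul_inv_cancel₀ hp0.ne', ENNReal.rpow_one] at main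
      have := ENNReal.toReal_mono (ENNReal.mul_ne_top hNt enorm_ne_top) main
      rwa [ENNReal.toReal_mul, toReal_enorm, toReal_enorm] at this
    rw [← ofReal_norm]
    exact ENNReal.ofReal_le_of_le_toReal hle
  · -- A nonnegative `f` in `L^p` is finite almost everywhere, so `T` may be applied to it.
    refine posNorm_le fun f hf h1 => ?_
    have hft : ∀ᵐ x ∂μ, f x < ⊤ := by
      have := ae_lt_top (hf.pow_const p.toReal) (h1.trans_lt ENNReal.one_lt_top).ne
      filter_upwards [this] with x hx
      exact (ENNReal.rpow_lt_top_iff_of_pos hp0).1 hx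
    have hgm : Measurable fun x => ((f x).toReal : ℂ) :=
      Complex.measurable_ofReal.comp hf.ennreal_toReal
    have hge : ∀ᵐ x ∂μ, ‖((f x).toReal : ℂ)‖ₑ = f x := by
      filter_upwards [hft] with x hx
      rw [← ofReal_norm, Complex.norm_real, Real.norm_of_nonneg ENNReal.toReal_nonneg,
        ENNReal.ofReal_toReal hx.ne]
    have hgint : ∫⁻ x, ‖((f x).toReal : ℂ)‖ₑ ^ p.toReal ∂μ = ∫⁻ x, f x ^ p.toReal ∂μ := by
      refine lintegral_congr_ae ?_
      filter_upwards [hge] with x hx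
      rw [hx]
    have hgL : MemLp (fun x => ((f x).toReal : ℂ)) p μ := by
      refine ⟨hgm.aestronglyMeasurable, ?_⟩
      rw [eLpNorm_lt_top_iff_lintegral_rpow_enorm_lt_top h0 hp, hgint]
      exact h1.trans_lt ENNReal.one_lt_top
    set g : Lp ℂ p μ := hgL.toLp _ with hg
    have hgae : ∀ᵐ x ∂μ, g x = ((f x).toReal : ℂ) := hgL.coeFn_toLp
    have hgn : ‖g‖ₑ ^ p.toReal ≤ 1 := by
      rw [enorm_Lp_rpow hp]
      refine le_trans (le_of_eq (lintegral_congr_ae ?_)) h1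
      filter_upwards [hgae, hge] with x hx hx'
      rw [hx, hx']
    have hTg : ∫⁻ x, posIntegral μ k f x ^ p.toReal ∂μ = ‖T g‖ₑ ^ p.toReal := by
      rw [enorm_Lp_rpow hp]
      refine lintegral_congr_ae ?_
      filter_upwards [hT g, hK] with z hz hKz
      congr 1
      rw [hz.2]
      have e1 : ∫ w, (‖K z w‖ : ℂ) * g w ∂μ = ((∫ w, ‖(‖K z w‖ : ℂ) * g w‖ ∂μ : ℝ) : ℂ) := by
        rw [← integral_complex_ofReal]
        refine integral_congr_ae ?_
        filter_upwards [hgae] with w hw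
        simp [hw]
      rw [e1, ← ofReal_norm, Complex.norm_real,
        Real.norm_of_nonneg (integral_nonneg fun _ => norm_nonneg _),
        ofReal_integral_norm_eq_lintegral_enorm hz.1]
      refine lintegral_congr_ae ?_
      filter_upwards [hKz, hgae, hge] with w hw hw1 hw2
      rw [enorm_mul, enorm_ofReal_norm, hw, hw1, hw2]
    rw [hTg]
    refine ENNReal.rpow_le_rpow ?_ hp0.le
    have h2 : ‖g‖ₑ ≤ 1 := by
      rwa [← ENNReal.le_rpow_inv_iff hp0, ENNReal.one_rpow] at hgn
    calc ‖T g‖ₑ ≤ ‖T‖ₑ * ‖g‖ₑ := T.le_opENorm g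
      _ ≤ ‖T‖ₑ * 1 := by gcongr
      _ = ‖T‖ₑ := mul_one _

theorem exists_isAbsIntegralOperator [SFinite μ] (hp : p ≠ ⊤) (hk : Measurable (Function.uncurry k))
    (hK : ∀ᵐ x ∂μ, ∀ᵐ y ∂μ, ‖K x y‖ₑ = k x y) (hfin : posNorm μ k p.toReal ≠ ⊤) :
    ∃ T : Lp ℂ p μ →L[ℂ] Lp ℂ p μ, IsAbsIntegralOperator μ K p T := by
  have h0 : p ≠ 0 := (lt_of_lt_of_le one_pos Fact.out).ne'
  have hp0 : 0 < p.toReal := ENNReal.toReal_pos h0 hp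
  have hKk : ∀ᵐ x ∂μ, ∀ᵐ y ∂μ, (‖K x y‖ : ℂ) = ((k x y).toReal : ℂ) := by
    filter_upwards [hK] with x hx
    filter_upwards [hx] with y hy
    rw [← hy, toReal_enorm]
  have hbound : ∀ f : Lp ℂ p μ, ∫⁻ x, posIntegral μ k (fun y => ‖f y‖ₑ) x ^ p.toReal ∂μ ≤
      posNorm μ k p.toReal * ‖f‖ₑ ^ p.toReal := by
    intro f
    rw [enorm_Lp_rpow hp]
    refine lintegral_posIntegral_rpow_le hk hp0 (measurable_enorm_Lp f) ?_
    rw [← enorm_Lp_rpow hp]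
    exact ENNReal.rpow_ne_top_of_nonneg hp0.le enorm_ne_top
  have hbfin : ∀ f : Lp ℂ p μ, posNorm μ k p.toReal * ‖f‖ₑ ^ p.toReal < ⊤ := fun f =>
    ENNReal.mul_lt_top hfin.lt_top (ENNReal.rpow_ne_top_of_nonneg hp0.le enorm_ne_top).lt_top
  have hmeas : ∀ f : Lp ℂ p μ,
      StronglyMeasurable fun a : X × X => ((k a.1 a.2).toReal : ℂ) * f a.2 := fun f =>
    (Complex.measurable_ofReal.comp hk.ennreal_toReal).stronglyMeasurable.mul
      ((Lp.stronglyMeasurable f).comp_measurable measurable_snd)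
  have hint : ∀ f : Lp ℂ p μ, ∀ᵐ z ∂μ, Integrable (fun w => (‖K z w‖ : ℂ) * f w) μ := by
    intro f
    filter_upwards [hKk, hK, ae_lt_top ((measurable_posIntegral hk (measurable_enorm_Lp f)).pow_const
      p.toReal) ((hbound f).trans_lt (hbfin f)).ne] with z hz hz' hlt
    have e : (fun w => (‖K z w‖ : ℂ) * f w) =ᵐ[μ] fun w => ((k z w).toReal : ℂ) * f w := by
      filter_upwards [hz] with w hw
      rw [hw]
    refine ⟨(((hmeas f).comp_measurable measurable_prodMk_left).aestronglyMeasurable).congr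
      e.symm, ?_⟩
    rw [ENNReal.rpow_lt_top_iff_of_pos hp0] at hlt
    refine lt_of_le_of_lt (le_of_eq (lintegral_congr_ae ?_)) hlt
    filter_upwards [hz'] with w hw
    rw [enorm_mul, enorm_ofReal_norm, hw]
  have hkint : ∀ f : Lp ℂ p μ, ∀ᵐ z ∂μ, ∫ w, ((k z w).toReal : ℂ) * f w ∂μ =
      ∫ w, (‖K z w‖ : ℂ) * f w ∂μ := by
    intro f
    filter_upwards [hKk] with z hz
    refine integral_congr_ae ?_
    filter_upwards [hz] with w hw
    rw [hw]
  have hmem : ∀ f : Lp ℂ p μ, MemLp (fun z => ∫ w, (‖K z w‖ : ℂ) * f w ∂μ) p μ := by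
    intro f
    refine ⟨((hmeas f).integral_prod_right').aestronglyMeasurable.congr (hkint f), ?_⟩
    rw [eLpNorm_lt_top_iff_lintegral_rpow_enorm_lt_top h0 hp]
    refine lt_of_le_of_lt (lintegral_mono_ae ?_) ((hbound f).trans_lt (hbfin f))
    filter_upwards [hK] with z hz
    refine ENNReal.rpow_le_rpow ((enorm_integral_le_lintegral_enorm _).trans
      (le_of_eq (lintegral_congr_ae ?_))) hp0.le
    filter_upwards [hz] with w hw
    rw [enorm_mul, enorm_ofReal_norm, hw]
  have hT0 : ∀ f : Lp ℂ p μ, ∀ᵐ z ∂μ, (hmem f).toLp _ z = ∫ w, (‖K z w‖ : ℂ) * f w ∂μ :=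
    fun f => (hmem f).coeFn_toLp
  let L : Lp ℂ p μ →ₗ[ℂ] Lp ℂ p μ :=
    { toFun := fun f => (hmem f).toLp _
      map_add' := fun f g => by
        apply Lp.ext
        filter_upwards [hT0 (f + g), Lp.coeFn_add ((hmem f).toLp _) ((hmem g).toLp _), hT0 f,
          hT0 g, hint f, hint g] with z h1 h2 h3 h4 h5 h6
        rw [h1, h2, Pi.add_apply, h3, h4, ← integral_add h5 h6]
        refine integral_congr_ae ?_
        filter_upwards [Lp.coeFn_add f g] with w hw
        rw [hw, Pi.add_apply, mul_add]
      map_smul' := fun c f => by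
        apply Lp.ext
        filter_upwards [hT0 (c • f), Lp.coeFn_smul c ((hmem f).toLp _), hT0 f] with z h1 h2 h3
        rw [h1, RingHom.id_apply, h2, Pi.smul_apply, h3, smul_eq_mul, ← integral_const_mul]
        refine integral_congr_ae ?_
        filter_upwards [Lp.coeFn_smul c f] with w hw
        rw [hw, Pi.smul_apply, smul_eq_mul]
        ring }
  have hL : ∀ f, ‖L f‖ ≤ (posNorm μ k p.toReal ^ (p.toReal)⁻¹).toReal * ‖f‖ := by
    intro f
    have hNt : posNorm μ k p.toReal ^ (p.toReal)⁻¹ ≠ ⊤ :=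
      ENNReal.rpow_ne_top_of_nonneg (inv_nonneg.2 hp0.le) hfin
    have main : ‖L f‖ₑ ^ p.toReal ≤ posNorm μ k p.toReal * ‖f‖ₑ ^ p.toReal := by
      rw [enorm_Lp_rpow hp]
      refine le_trans (lintegral_mono_ae ?_) (hbound f)
      filter_upwards [hT0 f, hK] with z hz hKz
      change ‖(hmem f).toLp _ z‖ₑ ^ p.toReal ≤ _
      rw [hz]
      refine ENNReal.rpow_le_rpow ((enorm_integral_le_lintegral_enorm _).trans
        (le_of_eq (lintegral_congr_ae ?_))) hp0.le
      filter_upwards [hKz] with w hw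
      rw [enorm_mul, enorm_ofReal_norm, hw]
    rw [← ENNReal.le_rpow_inv_iff hp0,
      ENNReal.mul_rpow_of_nonneg _ _ (inv_nonneg.2 hp0.le), ← ENNReal.rpow_mul,
      mul_inv_cancel₀ hp0.ne', ENNReal.rpow_one] at main
    have := ENNReal.toReal_mono (ENNReal.mul_ne_top hNt enorm_ne_top) main
    rwa [ENNReal.toReal_mul, toReal_enorm, toReal_enorm] at this
  refine ⟨L.mkContinuous _ hL, fun f => ?_⟩
  filter_upwards [hT0 f, hint f] with z hz hz'
  exact ⟨hz', hz⟩

end LpOperator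

/-! ### Properties of the Bergman kernel -/

section BergmanKernel

variable {E F : Type*} [NormedAddCommGroup E] [NormedSpace ℂ E] [MeasureSpace E]
  [NormedAddCommGroup F] [NormedSpace ℂ F] [MeasureSpace F]

theorem isBergmanKernel_bergmanKernel {Ω : Set E} (h : ∃ K, IsBergmanKernel Ω K) :
    IsBergmanKernel Ω (bergmanKernel Ω) := by
  unfold bergmanKernel
  rw [dif_pos h]
  exact h.choose_spec

/-- Any two reproducing kernels are conjugate transposes of each other. With `K = L` this is the
hermitian symmetry, and together with it the uniqueness of the kernel. -/
theorem IsBergmanKernel.eq_conj {Ω : Set E} {K L : E → E → ℂ} (hK : IsBergmanKernel Ω K)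
    (hL : IsBergmanKernel Ω L) {z w : E} (hz : z ∈ Ω) (hw : w ∈ Ω) :
    K z w = (starRingEnd ℂ) (L w z) := by
  rw [(hL z hz).2 _ (hK w hw).1, (hK w hw).2 _ (hL z hz).1, ← integral_conj]
  refine integral_congr_ae (Filter.Eventually.of_forall fun x => ?_)
  simp [mul_comm]

theorem IsBergmanKernel.unique {Ω : Set E} {K L : E → E → ℂ} (hK : IsBergmanKernel Ω K)
    (hL : IsBergmanKernel Ω L) {z w : E} (hz : z ∈ Ω) (hw : w ∈ Ω) : K z w = L z w := by
  rw [hK.eq_conj hL hz hw, hL.eq_conj hL hz hw]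

theorem IsBergmanKernel.norm_symm {Ω : Set E} {K : E → E → ℂ} (hK : IsBergmanKernel Ω K)
    {z w : E} (hz : z ∈ Ω) (hw : w ∈ Ω) : ‖K z w‖ = ‖K w z‖ := by
  rw [hK.eq_conj hK hz hw, RCLike.norm_conj]

theorem IsBergmanKernel.enorm_diag {Ω : Set E} {K : E → E → ℂ} (hK : IsBergmanKernel Ω K)
    {w : E} (hw : w ∈ Ω) : ‖K w w‖ₑ = ∫⁻ z in Ω, ‖K z w‖ₑ ^ (2 : ℝ) := by
  have h1 := (hK w hw).2 _ (hK w hw).1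
  have h2 : ∀ z, K z w * (starRingEnd ℂ) (K z w) = ((‖K z w‖ ^ 2 : ℝ) : ℂ) := fun z => by
    rw [Complex.mul_conj, Complex.normSq_eq_norm_sq]
  simp_rw [h2] at h1
  rw [integral_complex_ofReal] at h1
  have hint : Integrable (fun z => ‖K z w‖ ^ 2) (volume.restrict Ω) :=
    (hK w hw).1.2.integrable_norm_pow (by norm_num)
  rw [h1, ← ofReal_norm, Complex.norm_real,
    Real.norm_of_nonneg (integral_nonneg fun _ => by positivity),
    ofReal_integral_eq_lintegral_ofReal hint (Filter.Eventually.of_forall fun _ => by positivity)]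
  refine lintegral_congr fun z => ?_
  rw [ENNReal.ofReal_pow (norm_nonneg _), ofReal_norm]
  norm_cast

/-- The point evaluation estimate `|f(w)|² ≤ K(w, w) ‖f‖²`. -/
theorem IsBergmanKernel.enorm_sq_le {Ω : Set E} {K : E → E → ℂ} (hK : IsBergmanKernel Ω K)
    {f : E → ℂ} (hf : MemBergman Ω f) {w : E} (hw : w ∈ Ω) :
    ‖f w‖ₑ ^ (2 : ℝ) ≤ ‖K w w‖ₑ * ∫⁻ z in Ω, ‖f z‖ₑ ^ (2 : ℝ) := by
  have h2 : (2 : ℝ).HolderConjugate 2 := Real.HolderConjugate.two_two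
  have h : ‖f w‖ₑ ≤ (∫⁻ z in Ω, ‖f z‖ₑ ^ (2 : ℝ)) ^ (1 / (2 : ℝ)) *
      (∫⁻ z in Ω, ‖K z w‖ₑ ^ (2 : ℝ)) ^ (1 / (2 : ℝ)) := by
    rw [(hK w hw).2 f hf]
    refine (enorm_integral_le_lintegral_enorm _).trans ?_
    refine le_trans (le_of_eq ?_) (ENNReal.lintegral_mul_le_Lp_mul_Lq (volume.restrict Ω) h2
      hf.2.1.enorm (hK w hw).1.2.1.enorm)
    refine lintegral_congr fun z => ?_
    rw [enorm_mul, Pi.mul_apply]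
    simp
  calc ‖f w‖ₑ ^ (2 : ℝ) ≤ _ := ENNReal.rpow_le_rpow h (by norm_num)
    _ = ‖K w w‖ₑ * ∫⁻ z in Ω, ‖f z‖ₑ ^ (2 : ℝ) := by
      rw [ENNReal.mul_rpow_of_nonneg _ _ (by norm_num), ← ENNReal.rpow_mul, ← ENNReal.rpow_mul,
        hK.enorm_diag hw]
      norm_num
      rw [mul_comm]

/-- Testing on the constant function `1`. -/
theorem IsBergmanKernel.one_le_diag {Ω : Set E} {K : E → E → ℂ} (hK : IsBergmanKernel Ω K)
    (hΩ : volume Ω ≠ ⊤) {w : E} (hw : w ∈ Ω) : 1 ≤ ‖K w w‖ * (volume Ω).toReal := by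
  have : IsFiniteMeasure (volume.restrict Ω) := ⟨by simpa using hΩ.lt_top⟩
  have h1 : MemBergman Ω (fun _ : E => (1 : ℂ)) := ⟨differentiableOn_const _, memLp_const _⟩
  have h := hK.enorm_sq_le h1 hw
  simp only [enorm_one, ENNReal.one_rpow, lintegral_const, MeasurableSet.univ,
    Measure.restrict_apply, univ_inter, one_mul] at h
  have := ENNReal.toReal_mono (ENNReal.mul_ne_top enorm_ne_top hΩ) h
  rwa [ENNReal.toReal_mul, toReal_enorm, ENNReal.toReal_one] at this

theorem lintegral_enorm_sq_lt_top {X : Type*} [MeasurableSpace X] {μ : Measure X} {f : X → ℂ}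
    (hf : MemLp f 2 μ) : ∫⁻ x, ‖f x‖ₑ ^ (2 : ℝ) ∂μ < ⊤ := by
  have := (eLpNorm_lt_top_iff_lintegral_rpow_enorm_lt_top (by norm_num) (by norm_num)).1 hf.2
  simpa using this

theorem memLp_two_of_lintegral {X : Type*} [MeasurableSpace X] {μ : Measure X} {f : X → ℂ}
    (hf : AEStronglyMeasurable f μ) (h : ∫⁻ x, ‖f x‖ₑ ^ (2 : ℝ) ∂μ < ⊤) : MemLp f 2 μ := by
  refine ⟨hf, (eLpNorm_lt_top_iff_lintegral_rpow_enorm_lt_top (by norm_num) (by norm_num)).2 ?_⟩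
  simpa using h

/-- The Bergman kernel of a product of two sets is the product of the kernels. For `f ∈ A²` of
the product, the slice `f(·, w₂)` is square integrable by the point evaluation estimate for the
second factor, so the reproducing formulas may be applied one after the other. -/
theorem IsBergmanKernel.prod [BorelSpace E] [SecondCountableTopology E]
    [SigmaFinite (volume : Measure E)] [SigmaFinite (volume : Measure F)] {Ω : Set E} {Ω' : Set F}
    (ho : IsOpen Ω) {K : E → E → ℂ} {L : F → F → ℂ}
    (hK : IsBergmanKernel Ω K) (hL : IsBergmanKernel Ω' L) :
    IsBergmanKernel (Ω ×ˢ Ω') (fun a b : E × F => K a.1 b.1 * L a.2 b.2) := by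
  have hrestr : (volume : Measure (E × F)).restrict (Ω ×ˢ Ω') =
      (volume.restrict Ω).prod (volume.restrict Ω') := by
    rw [Measure.prod_restrict]
    rfl
  rintro ⟨w₁, w₂⟩ ⟨hw₁, hw₂⟩
  have hKL : MemBergman (Ω ×ˢ Ω') (fun a : E × F => K a.1 w₁ * L a.2 w₂) := by
    refine ⟨?_, ?_⟩
    · refine DifferentiableOn.mul ?_ ?_
      · exact (hK w₁ hw₁).1.1.comp differentiable_fst.differentiableOn fun a ha => ha.1
      · exact (hL w₂ hw₂).1.1.comp differentiable_snd.differentiableOn fun a ha => ha.2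
    · rw [hrestr]
      have m1 := (hK w₁ hw₁).1.2
      have m2 := (hL w₂ hw₂).1.2
      refine memLp_two_of_lintegral (m1.1.comp_fst.mul m2.1.comp_snd) ?_
      simp_rw [enorm_mul, ENNReal.mul_rpow_of_nonneg _ _ (by norm_num : (0 : ℝ) ≤ 2)]
      rw [lintegral_prod_mul (m1.1.enorm.pow_const _) (m2.1.enorm.pow_const _)]
      exact ENNReal.mul_lt_top (lintegral_enorm_sq_lt_top m1) (lintegral_enorm_sq_lt_top m2)
  refine ⟨hKL, fun f hf => ?_⟩
  have hf2 : MemLp f 2 ((volume.restrict Ω).prod (volume.restrict Ω')) := hrestr ▸ hf.2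
  have hfin := lintegral_enorm_sq_lt_top hf2
  rw [lintegral_prod _ (hf2.1.enorm.pow_const _)] at hfin
  have hslice : ∀ᵐ z ∂(volume.restrict Ω), MemBergman Ω' (fun y => f (z, y)) := by
    filter_upwards [ae_lt_top' (AEMeasurable.lintegral_prod_right' (hf2.1.enorm.pow_const (2 : ℝ)))
      hfin.ne, hf2.1.prodMk_left, ae_restrict_mem ho.measurableSet] with z hz hz' hzΩ
    refine ⟨?_, memLp_two_of_lintegral hz' hz⟩
    refine hf.1.comp (f := fun y => (z, y)) ?_ fun y hy => ⟨hzΩ, hy⟩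
    exact ((differentiable_const z).prodMk differentiable_id).differentiableOn
  have hslice2 : MemBergman Ω (fun z => f (z, w₂)) := by
    have hd : DifferentiableOn ℂ (fun z => f (z, w₂)) Ω := by
      refine hf.1.comp (f := fun z => (z, w₂)) ?_ fun y hy => ⟨hy, hw₂⟩
      exact (differentiable_id.prodMk (differentiable_const w₂)).differentiableOn
    refine ⟨hd, memLp_two_of_lintegral
      (hd.continuousOn.aestronglyMeasurable ho.measurableSet) ?_⟩
    calc ∫⁻ z in Ω, ‖f (z, w₂)‖ₑ ^ (2 : ℝ)
        ≤ ∫⁻ z in Ω, ‖L w₂ w₂‖ₑ * ∫⁻ y in Ω', ‖f (z, y)‖ₑ ^ (2 : ℝ) := by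
          refine lintegral_mono_ae ?_
          filter_upwards [hslice] with z hz
          exact hL.enorm_sq_le hz hw₂
      _ = ‖L w₂ w₂‖ₑ * ∫⁻ z in Ω, ∫⁻ y in Ω', ‖f (z, y)‖ₑ ^ (2 : ℝ) :=
          lintegral_const_mul' _ _ enorm_ne_top
      _ < ⊤ := ENNReal.mul_lt_top enorm_lt_top hfin
  have hint : Integrable (fun a : E × F => f a * (starRingEnd ℂ) (K a.1 w₁ * L a.2 w₂))
      ((volume.restrict Ω).prod (volume.restrict Ω')) :=
    hf2.integrable_mul (hrestr ▸ hKL.2.star)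
  change f (w₁, w₂) = ∫ a in Ω ×ˢ Ω', f a * (starRingEnd ℂ) (K a.1 w₁ * L a.2 w₂)
  rw [hrestr, integral_prod _ hint, (hK w₁ hw₁).2 _ hslice2]
  refine integral_congr_ae ?_
  filter_upwards [hslice] with z hz
  rw [(hL w₂ hw₂).2 _ hz, ← integral_mul_const]
  refine integral_congr_ae (Filter.Eventually.of_forall fun y => ?_)
  simp only [map_mul]
  ring

/-- Invariance under measure preserving linear changes of coordinates. -/
theorem IsBergmanKernel.comp_equiv {Ω : Set F} {K : F → F → ℂ} (hK : IsBergmanKernel Ω K)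
    (e : E ≃L[ℂ] F) (he : MeasurePreserving e volume volume) (hemb : MeasurableEmbedding e) :
    IsBergmanKernel (e ⁻¹' Ω) (fun z w => K (e z) (e w)) := by
  have hr := he.restrict_preimage_emb hemb Ω
  have hmem : ∀ f : F → ℂ, MemLp f 2 (volume.restrict Ω) ↔
      MemLp (f ∘ e) 2 (volume.restrict (e ⁻¹' Ω)) := fun f => by
    rw [← hemb.memLp_map_measure_iff, hr.map_eq]
  intro w hw
  refine ⟨⟨(hK _ hw).1.1.comp e.differentiable.differentiableOn fun z hz => hz,
    (hmem fun z => K z (e w)).1 (hK _ hw).1.2⟩, fun f hf => ?_⟩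
  have hf' : (f ∘ e.symm) ∘ e = f := by
    funext z
    simp
  have hg : MemBergman Ω (f ∘ e.symm) := by
    refine ⟨hf.1.comp e.symm.differentiable.differentiableOn fun z hz => by simpa using hz, ?_⟩
    rw [hmem, hf']
    exact hf.2
  have := (hK _ hw).2 _ hg
  rw [← hr.integral_comp hemb] at this
  simpa using this

/-- The Bergman kernel of a finite product of open sets is the product of the kernels. -/
theorem IsBergmanKernel.pi {m : ℕ} {V : Fin m → Type*} [∀ i, NormedAddCommGroup (V i)]
    [∀ i, NormedSpace ℂ (V i)] [∀ i, MeasureSpace (V i)] [∀ i, BorelSpace (V i)]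
    [∀ i, SecondCountableTopology (V i)] [∀ i, SigmaFinite (volume : Measure (V i))]
    {Ω : ∀ i, Set (V i)} (ho : ∀ i, IsOpen (Ω i)) {K : ∀ i, V i → V i → ℂ}
    (hK : ∀ i, IsBergmanKernel (Ω i) (K i)) :
    IsBergmanKernel (univ.pi Ω) (fun z w => ∏ i, K i (z i) (w i)) := by
  induction m with
  | zero =>
    intro w _
    have hvol : (volume : Measure (∀ i, V i)).restrict (univ.pi Ω) = Measure.dirac w := by
      have hu : univ.pi Ω = univ := by
        ext z
        simp
      rw [hu, Measure.restrict_univ, volume_pi, Measure.pi_of_empty _ w]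
    simp only [Finset.univ_eq_empty, Finset.prod_empty, map_one, mul_one]
    refine ⟨⟨differentiableOn_const _, ?_⟩, fun f _ => ?_⟩
    · rw [hvol]
      exact memLp_const _
    · rw [hvol, integral_dirac]
  | succ m ih =>
    have h1 := (hK 0).prod (ho 0)
      (ih (fun i => ho i.succ) fun i => hK i.succ)
    have hpres : MeasurePreserving (Fin.consEquivL ℂ V).symm volume volume :=
      volume_preserving_piFinSuccAbove V 0
    have hemb : MeasurableEmbedding (Fin.consEquivL ℂ V).symm :=
      (MeasurableEquiv.piFinSuccAbove V 0).measurableEmbedding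
    have h2 := h1.comp_equiv _ hpres hemb
    have hset : (Fin.consEquivL ℂ V).symm ⁻¹' (Ω 0 ×ˢ univ.pi fun i : Fin m => Ω i.succ) = univ.pi Ω := by
      ext z
      simp only [mem_preimage, mem_prod, mem_univ_pi]
      exact (Fin.forall_fin_succ (P := fun i => z i ∈ Ω i)).symm
    rw [hset] at h2
    refine Eq.mp ?_ h2
    congr 1
    funext z w
    rw [Fin.prod_univ_succ]
    rfl

/-- The modulus of the Bergman kernel, extended by zero off `Ω × Ω`. -/
def absKernel (Ω : Set E) (z w : E) : ℝ≥0∞ :=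
  (Ω ×ˢ Ω).indicator (fun a => ‖bergmanKernel Ω a.1 a.2‖ₑ) (z, w)

theorem absKernel_of_mem {Ω : Set E} {z w : E} (hz : z ∈ Ω) (hw : w ∈ Ω) :
    absKernel Ω z w = ‖bergmanKernel Ω z w‖ₑ :=
  indicator_of_mem (mk_mem_prod hz hw) _

theorem absKernel_symm {Ω : Set E} (h : ∃ K, IsBergmanKernel Ω K) (z w : E) :
    absKernel Ω z w = absKernel Ω w z := by
  by_cases hz : z ∈ Ω
  · by_cases hw : w ∈ Ω
    · rw [absKernel_of_mem hz hw, absKernel_of_mem hw hz, ← ofReal_norm, ← ofReal_norm,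
        (isBergmanKernel_bergmanKernel h).norm_symm hz hw]
    · simp [absKernel, hw]
  · simp [absKernel, hz]

/-- Joint measurability: on `Ω × Ω` the kernel is continuous in each variable. -/
theorem measurable_absKernel [BorelSpace E] [SecondCountableTopology E] {Ω : Set E}
    (ho : IsOpen Ω) (h : ∃ K, IsBergmanKernel Ω K) :
    Measurable (Function.uncurry (absKernel Ω)) := by
  have hK := isBergmanKernel_bergmanKernel h
  have hc1 : ∀ w : Ω, Continuous fun z : Ω => bergmanKernel Ω z w := fun w =>
    continuousOn_iff_continuous_domRestrict.1 (hK w w.2).1.1.continuousOn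
  have hc2 : ∀ z : Ω, Continuous fun w : Ω => bergmanKernel Ω z w := fun z => by
    have : (fun w : Ω => bergmanKernel Ω z w) =
        fun w : Ω => (starRingEnd ℂ) (bergmanKernel Ω w z) := by
      funext w
      exact hK.eq_conj hK z.2 w.2
    rw [this]
    exact Complex.continuous_conj.comp (hc1 z)
  have hm : Measurable (Function.uncurry fun z w : Ω => bergmanKernel Ω z w) :=
    measurable_uncurry_of_continuous_of_measurable hc1 fun z => (hc2 z).measurable
  have hs : MeasurableSet (Ω ×ˢ Ω) := ho.measurableSet.prod ho.measurableSet
  change Measurable ((Ω ×ˢ Ω).indicator fun a => ‖bergmanKernel Ω a.1 a.2‖ₑ)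
  classical
  rw [← piecewise_eq_indicator]
  refine measurable_of_restrict_of_restrict_compl hs ?_ ?_
  · rw [domRestrict_piecewise]
    exact hm.enorm.comp (f := fun a : (Ω ×ˢ Ω : Set (E × E)) =>
      ((⟨a.1.1, a.2.1⟩ : Ω), (⟨a.1.2, a.2.2⟩ : Ω)))
      (((measurable_fst.comp measurable_subtype_coe).subtype_mk).prodMk
        ((measurable_snd.comp measurable_subtype_coe).subtype_mk))
  · rw [domRestrict_piecewise_compl]
    exact measurable_const

end BergmanKernel

/-! ### Integrals of negative powers along transverse lines -/

section Lines

theorem lintegral_Ioo_enorm_rpow_le {a t : ℝ} (ha : a < 1) (ht : 0 < t) :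
    ∫⁻ u in Ioo (-t) t, ‖u‖ₑ ^ (-a) ≤ ENNReal.ofReal (2 / (1 - a) * t ^ (1 - a)) := by
  have hpos : ∫⁻ u in Ioc 0 t, ‖u‖ₑ ^ (-a) = ENNReal.ofReal (t ^ (1 - a) / (1 - a)) := by
    have hint : IntegrableOn (fun u : ℝ => u ^ (-a)) (Ioc 0 t) := by
      have := intervalIntegral.intervalIntegrable_rpow' (a := 0) (b := t) (r := -a) (by linarith)
      rwa [intervalIntegrable_iff_integrableOn_Ioc_of_le ht.le] at this
    have e1 : ∫⁻ u in Ioc 0 t, ‖u‖ₑ ^ (-a) = ∫⁻ u in Ioc 0 t, ENNReal.ofReal (u ^ (-a)) := by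
      refine setLIntegral_congr_fun measurableSet_Ioc fun u hu => ?_
      rw [← ENNReal.ofReal_rpow_of_pos hu.1, ← ofReal_norm, Real.norm_of_nonneg hu.1.le]
    rw [e1, ← ofReal_integral_eq_lintegral_ofReal hint
      ((ae_restrict_mem measurableSet_Ioc).mono fun u hu => Real.rpow_nonneg hu.1.le _),
      ← intervalIntegral.integral_of_le ht.le, integral_rpow (Or.inl (by linarith))]
    rw [Real.zero_rpow (by linarith), sub_zero, neg_add_eq_sub]
  have hneg : ∫⁻ u in Neg.neg ⁻¹' Ioc 0 t, ‖u‖ₑ ^ (-a) = ∫⁻ u in Ioc 0 t, ‖u‖ₑ ^ (-a) := by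
    have := (Measure.measurePreserving_neg (volume : Measure ℝ)).setLIntegral_comp_preimage
      (measurableSet_Ioc (a := 0) (b := t)) (f := fun u : ℝ => ‖u‖ₑ ^ (-a))
      (measurable_enorm.pow_const _)
    simpa only [enorm_neg] using this
  have hsub : Ioo (-t) t ⊆ Ioc 0 t ∪ (Neg.neg ⁻¹' Ioc 0 t ∪ {0}) := by
    intro u hu
    rcases lt_trichotomy u 0 with h | h | h
    · refine Or.inr (Or.inl ⟨by simpa using h, ?_⟩)
      exact (neg_lt.1 hu.1).le
    · exact Or.inr (Or.inr h)
    · exact Or.inl ⟨h, hu.2.le⟩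
  calc ∫⁻ u in Ioo (-t) t, ‖u‖ₑ ^ (-a)
      ≤ (∫⁻ u in Ioc 0 t, ‖u‖ₑ ^ (-a)) + ((∫⁻ u in Neg.neg ⁻¹' Ioc 0 t, ‖u‖ₑ ^ (-a)) +
          ∫⁻ u in {(0 : ℝ)}, ‖u‖ₑ ^ (-a)) := by
        refine (lintegral_mono_set hsub).trans ((lintegral_union_le _ _ _).trans ?_)
        gcongr
        exact lintegral_union_le _ _ _
    _ = ENNReal.ofReal (2 / (1 - a) * t ^ (1 - a)) := by
        have h0 : 0 ≤ t ^ (1 - a) / (1 - a) := by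
          have : 0 < 1 - a := by linarith
          positivity
        rw [hneg, hpos, setLIntegral_measure_zero _ _ Real.volume_singleton, add_zero,
          ← ENNReal.ofReal_add h0 h0]
        congr 1
        ring

/-- The bound is uniform in the position `c` of the singularity. -/
theorem lintegral_Ioo_enorm_sub_rpow_le {a t : ℝ} (ha0 : 0 ≤ a) (ha : a < 1) (ht : 0 < t) (c : ℝ) :
    ∫⁻ s in Ioo (-t) t, ‖s - c‖ₑ ^ (-a) ≤
      ENNReal.ofReal ((2 + 2 / (1 - a)) * t ^ (1 - a)) := by
  have hpt : ∀ s : ℝ, ‖s - c‖ₑ ^ (-a) ≤ ENNReal.ofReal t ^ (-a) +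
      (Ioo (-t) t).indicator (fun u => ‖u‖ₑ ^ (-a)) (s - c) := by
    intro s
    by_cases h : s - c ∈ Ioo (-t) t
    · rw [indicator_of_mem h]
      exact le_add_self
    · refine le_trans ?_ le_self_add
      rw [ENNReal.rpow_neg, ENNReal.rpow_neg, ENNReal.inv_le_inv]
      refine ENNReal.rpow_le_rpow ?_ ha0
      rw [← ofReal_norm]
      refine ENNReal.ofReal_le_ofReal ?_
      by_contra! h'
      exact h (abs_lt.1 h')
  have h1a : 0 < 1 - a := by linarith
  calc ∫⁻ s in Ioo (-t) t, ‖s - c‖ₑ ^ (-a)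
      ≤ ∫⁻ s in Ioo (-t) t, (ENNReal.ofReal t ^ (-a) +
        (Ioo (-t) t).indicator (fun u => ‖u‖ₑ ^ (-a)) (s - c)) := lintegral_mono fun s => hpt s
    _ = ENNReal.ofReal t ^ (-a) * volume (Ioo (-t) t) +
        ∫⁻ s in Ioo (-t) t, (Ioo (-t) t).indicator (fun u => ‖u‖ₑ ^ (-a)) (s - c) := by
        rw [lintegral_add_left measurable_const, setLIntegral_const]
    _ ≤ ENNReal.ofReal t ^ (-a) * volume (Ioo (-t) t) +
        ∫⁻ s, (Ioo (-t) t).indicator (fun u => ‖u‖ₑ ^ (-a)) (s - c) := by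
        gcongr
        exact Measure.restrict_le_self
    _ ≤ ENNReal.ofReal (2 * t ^ (1 - a)) + ENNReal.ofReal (2 / (1 - a) * t ^ (1 - a)) := by
        rw [lintegral_sub_right_eq_self (fun s => (Ioo (-t) t).indicator
          (fun u => ‖u‖ₑ ^ (-a)) s) c, lintegral_indicator measurableSet_Ioo]
        gcongr
        · rw [Real.volume_Ioo, ENNReal.ofReal_rpow_of_pos ht, ← ENNReal.ofReal_mul (by positivity)]
          refine le_of_eq (congrArg _ ?_)
          rw [sub_eq_add_neg 1 a, Real.rpow_add ht, Real.rpow_one]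
          ring
        · exact lintegral_Ioo_enorm_rpow_le ha ht
    _ = _ := by
        rw [← ENNReal.ofReal_add (by positivity) (by positivity)]
        congr 1
        ring

/-- An expanding function on a set of reals is bounded below by the distance to a fixed point
`c`, even when it has no zero. -/
theorem exists_abs_sub_le_of_expanding {I : Set ℝ} {g : ℝ → ℝ} {C : ℝ}
    (h : ∀ s ∈ I, ∀ t ∈ I, |s - t| ≤ C * |g s - g t|) (hC : 0 ≤ C) :
    ∃ c, ∀ s ∈ I, |s - c| ≤ C * |g s| := by
  rcases I.eq_empty_or_nonempty with rfl | ⟨t₀, ht₀⟩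
  · exact ⟨0, fun s hs => hs.elim⟩
  -- The intervals `[s - C |g s|, s + C |g s|]` meet pairwise, hence have a common point.
  have hle : ∀ s ∈ I, ∀ t ∈ I, s - C * |g s| ≤ t + C * |g t| := by
    intro s hs t ht
    have h1 := (le_abs_self _).trans (h s hs t ht)
    have h2 : C * |g s - g t| ≤ C * (|g s| + |g t|) := by
      gcongr
      exact abs_sub _ _
    linarith
  have hbdd : BddAbove ((fun s => s - C * |g s|) '' I) :=
    ⟨t₀ + C * |g t₀|, by rintro _ ⟨s, hs, rfl⟩; exact hle s hs t₀ ht₀⟩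
  refine ⟨sSup ((fun s => s - C * |g s|) '' I), fun s hs => ?_⟩
  have h1 : s - C * |g s| ≤ sSup ((fun s => s - C * |g s|) '' I) :=
    le_csSup hbdd ⟨s, hs, rfl⟩
  have h2 : sSup ((fun s => s - C * |g s|) '' I) ≤ s + C * |g s| :=
    csSup_le ⟨_, t₀, ht₀, rfl⟩ (by rintro _ ⟨t, ht, rfl⟩; exact hle t ht s hs)
  rw [abs_le]
  constructor <;> linarith

theorem expanding_of_le_abs_deriv {I : Set ℝ} (hI : Convex ℝ I) {g g' : ℝ → ℝ} {C : ℝ}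
    (hC : 0 < C) (hg : ∀ s ∈ I, HasDerivAt g (g' s) s) (hg' : ∀ s ∈ I, 1 / C ≤ |g' s|) :
    ∀ s ∈ I, ∀ t ∈ I, |s - t| ≤ C * |g s - g t| := by
  have main : ∀ s ∈ I, ∀ t ∈ I, s < t → |s - t| ≤ C * |g s - g t| := by
    intro s hs t ht hst
    have hsub : Icc s t ⊆ I := hI.ordConnected.out hs ht
    obtain ⟨x, hx, hxe⟩ := exists_hasDerivAt_eq_slope g g' hst
      (fun y hy => (hg y (hsub hy)).continuousAt.continuousWithinAt)
      (fun y hy => hg y (hsub (Ioo_subset_Icc_self hy)))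
    have h1 := hg' x (hsub (Ioo_subset_Icc_self hx))
    have hpos : 0 < t - s := sub_pos.2 hst
    rw [hxe, abs_div, abs_of_pos hpos, div_le_div_iff₀ hC hpos, one_mul] at h1
    rw [abs_sub_comm s t, abs_of_pos hpos, abs_sub_comm (g s), mul_comm]
    exact h1
  intro s hs t ht
  rcases lt_trichotomy s t with h | h | h
  · exact main s hs t ht h
  · simp [h]
  · rw [abs_sub_comm s, abs_sub_comm (g s)]
    exact main t ht s hs h

theorem lintegral_enorm_rpow_le_of_expanding {I : Set ℝ} {g : ℝ → ℝ} {C a t : ℝ} (ha0 : 0 ≤ a)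
    (ha : a < 1) (ht : 0 < t) (hC : 0 < C)
    (h : ∀ s ∈ I, ∀ t ∈ I, |s - t| ≤ C * |g s - g t|) :
    ∫⁻ s in Ioo (-t) t, I.indicator (fun s => ‖g s‖ₑ ^ (-a)) s ≤
      ENNReal.ofReal (C ^ a * (2 + 2 / (1 - a)) * t ^ (1 - a)) := by
  obtain ⟨c, hc⟩ := exists_abs_sub_le_of_expanding h hC.le
  have hpt : ∀ s, I.indicator (fun s => ‖g s‖ₑ ^ (-a)) s ≤
      ENNReal.ofReal (C ^ a) * ‖s - c‖ₑ ^ (-a) := by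
    intro s
    by_cases hs : s ∈ I
    · rw [indicator_of_mem hs]
      have h1 : ‖s - c‖ₑ ≤ ENNReal.ofReal C * ‖g s‖ₑ := by
        rw [← ofReal_norm, ← ofReal_norm, ← ENNReal.ofReal_mul hC.le]
        exact ENNReal.ofReal_le_ofReal (hc s hs)
      have h2 := ENNReal.inv_le_inv.2 (ENNReal.rpow_le_rpow h1 ha0)
      rw [ENNReal.mul_rpow_of_nonneg _ _ ha0, ENNReal.ofReal_rpow_of_pos hC] at h2
      have hC0 : ENNReal.ofReal (C ^ a) ≠ 0 := by
        rw [Ne, ENNReal.ofReal_eq_zero, not_le]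
        positivity
      rw [ENNReal.rpow_neg, ENNReal.rpow_neg]
      calc (‖g s‖ₑ ^ a)⁻¹
          = ENNReal.ofReal (C ^ a) * (ENNReal.ofReal (C ^ a) * ‖g s‖ₑ ^ a)⁻¹ := by
            rw [ENNReal.mul_inv (Or.inl hC0) (Or.inl ENNReal.ofReal_ne_top), ← mul_assoc,
              ENNReal.mul_inv_cancel hC0 ENNReal.ofReal_ne_top, one_mul]
        _ ≤ _ := by gcongr
    · rw [indicator_of_notMem hs]
      exact zero_le
  have hC' : 0 ≤ C ^ a := by positivity
  calc ∫⁻ s in Ioo (-t) t, I.indicator (fun s => ‖g s‖ₑ ^ (-a)) s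
      ≤ ∫⁻ s in Ioo (-t) t, ENNReal.ofReal (C ^ a) * ‖s - c‖ₑ ^ (-a) :=
        lintegral_mono fun s => hpt s
    _ = ENNReal.ofReal (C ^ a) * ∫⁻ s in Ioo (-t) t, ‖s - c‖ₑ ^ (-a) :=
        lintegral_const_mul' _ _ ENNReal.ofReal_ne_top
    _ ≤ ENNReal.ofReal (C ^ a) * ENNReal.ofReal ((2 + 2 / (1 - a)) * t ^ (1 - a)) := by
        gcongr
        exact lintegral_Ioo_enorm_sub_rpow_le ha0 ha ht c
    _ = _ := by rw [← ENNReal.ofReal_mul hC', mul_assoc]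

/-- If the integrals of `F` over all segments of length `2t` in direction `e` are at most `M`,
then averaging over the translations along `e` bounds `∫ F` by `M / 2t` times the volume of any
set containing all these translates of the support of `F`. -/
theorem lintegral_le_of_lintegral_segment_le {V : Type*} [NormedAddCommGroup V] [NormedSpace ℝ V]
    [MeasurableSpace V] [BorelSpace V] [SecondCountableTopology V] {μ : Measure V} [SFinite μ]
    [μ.IsAddRightInvariant] {F : V → ℝ≥0∞} (hF : Measurable F) {D : Set V} (hD : MeasurableSet D)
    {e : V} {t : ℝ} {M : ℝ≥0∞} (hM : ∀ ζ, ∫⁻ s in Ioo (-t) t, F (ζ + s • e) ≤ M)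
    (hsupp : ∀ ζ, ∀ s ∈ Ioo (-t) t, F (ζ + s • e) ≠ 0 → ζ ∈ D) :
    ENNReal.ofReal (2 * t) * ∫⁻ ζ, F ζ ∂μ ≤ M * μ D := by
  have hmeas : Measurable fun x : ℝ × V => F (x.2 + x.1 • e) :=
    hF.comp (measurable_snd.add (measurable_fst.smul_const e))
  have hpt : ∀ ζ, ∫⁻ s in Ioo (-t) t, F (ζ + s • e) ≤ D.indicator (fun _ => M) ζ := by
    intro ζ
    by_cases h : ζ ∈ D
    · rw [indicator_of_mem h]
      exact hM ζ
    · rw [indicator_of_notMem h, nonpos_iff_eq_zero]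
      rw [setLIntegral_congr_fun measurableSet_Ioo (g := fun _ => 0), lintegral_zero]
      intro s hs
      by_contra h'
      exact h (hsupp ζ s hs h')
  calc ENNReal.ofReal (2 * t) * ∫⁻ ζ, F ζ ∂μ
      = ∫⁻ _ in Ioo (-t) t, ∫⁻ ζ, F ζ ∂μ := by
        rw [setLIntegral_const, Real.volume_Ioo, mul_comm, sub_neg_eq_add, two_mul]
    _ = ∫⁻ s in Ioo (-t) t, (∫⁻ ζ, F (ζ + s • e) ∂μ) := by
        refine lintegral_congr fun s => ?_
        rw [lintegral_add_right_eq_self]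
    _ = ∫⁻ ζ, (∫⁻ s in Ioo (-t) t, F (ζ + s • e)) ∂μ :=
        lintegral_lintegral_swap hmeas.aemeasurable
    _ ≤ ∫⁻ ζ, D.indicator (fun _ => M) ζ ∂μ := lintegral_mono hpt
    _ = M * μ D := by rw [lintegral_indicator hD, setLIntegral_const]

/-- The change of variables inequality for a Lipschitz map. -/
theorem lintegral_image_le_of_lipschitzOnWith {V : Type*} [NormedAddCommGroup V] [NormedSpace ℝ V]
    [FiniteDimensional ℝ V] [MeasurableSpace V] [BorelSpace V] (μ : Measure V) [μ.IsAddHaarMeasure]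
    {Ψ : V → V} {D : Set V} (hD : MeasurableSet D) {K : NNReal} (hΨ : LipschitzOnWith K Ψ D)
    {F : V → ℝ≥0∞} (hF : Measurable F) :
    ∫⁻ w in Ψ '' D, F w ∂μ ≤
      (K : ℝ≥0∞) ^ Module.finrank ℝ V * ∫⁻ ζ in D, F (Ψ ζ) ∂μ := by
  have hvol : ∀ S ⊆ D, μ (Ψ '' S) ≤ (K : ℝ≥0∞) ^ Module.finrank ℝ V * μ S := by
    intro S hS
    have : (Measure.hausdorffMeasure (Module.finrank ℝ V : ℝ) : Measure V).IsAddHaarMeasure :=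
      isAddHaarMeasure_hausdorffMeasure
    have h := (hΨ.mono hS).hausdorffMeasure_image_le (d := Module.finrank ℝ V) (Nat.cast_nonneg _)
    rw [Measure.isAddLeftInvariant_eq_smul μ
      (Measure.hausdorffMeasure (Module.finrank ℝ V : ℝ) : Measure V), Measure.smul_apply,
      Measure.smul_apply, mul_smul_comm]
    rw [ENNReal.rpow_natCast] at h
    gcongr
  have hm : AEMeasurable Ψ (μ.restrict D) := hΨ.continuousOn.aemeasurable hD
  have hle : μ.restrict (Ψ '' D) ≤
      (K : ℝ≥0∞) ^ Module.finrank ℝ V • (μ.restrict D).map Ψ := by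
    refine Measure.le_iff.2 fun S hS => ?_
    rw [Measure.restrict_apply hS, Measure.smul_apply, Measure.map_apply_of_aemeasurable hm hS,
      smul_eq_mul, Measure.restrict_apply' hD]
    refine le_trans (measure_mono ?_) (hvol (Ψ ⁻¹' S ∩ D) inter_subset_right)
    rintro _ ⟨h1, ζ, hζ, rfl⟩
    exact ⟨ζ, ⟨h1, hζ⟩, rfl⟩
  refine (lintegral_mono' hle le_rfl).trans ?_
  rw [lintegral_smul_measure, lintegral_map' hF.aemeasurable hm, smul_eq_mul]

end Lines

/-! ### Integrals of negative powers of the defining function over polydiscs -/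

section Polydisc

variable {n : ℕ}

/-- Since the volume is some Haar measure, polydiscs have volume a constant times the product of the
squared radii. -/
theorem exists_volume_polydisc_le (n : ℕ) : ∃ κ : ℝ, 0 ≤ κ ∧ ∀ t : Fin n → ℝ, (∀ j, 0 < t j) →
    volume {ζ : EuclideanSpace ℂ (Fin n) | ∀ j, ‖ζ j‖ < t j} ≤
      ENNReal.ofReal (κ * ∏ j, t j ^ 2) := by
  let φ := EuclideanSpace.equiv (Fin n) ℂ
  have : (Measure.map φ (volume : Measure (EuclideanSpace ℂ (Fin n)))).IsAddHaarMeasure :=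
    φ.isAddHaarMeasure_map _
  have heq := Measure.isAddLeftInvariant_eq_smul
    (Measure.map φ (volume : Measure (EuclideanSpace ℂ (Fin n)))) (volume : Measure (Fin n → ℂ))
  set c := (Measure.map φ (volume : Measure (EuclideanSpace ℂ (Fin n)))).addHaarScalarFactor
    (volume : Measure (Fin n → ℂ))
  refine ⟨c * Real.pi ^ n, by positivity, fun t ht => ?_⟩
  have hset : {ζ : EuclideanSpace ℂ (Fin n) | ∀ j, ‖ζ j‖ < t j} =
      φ ⁻¹' (univ.pi fun j => ball (0 : ℂ) (t j)) := by
    ext ζ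
    simp [φ]
  have hm : MeasurableSet (univ.pi fun j => ball (0 : ℂ) (t j)) :=
    MeasurableSet.univ_pi fun j => measurableSet_ball
  rw [hset, ← Measure.map_apply φ.continuous.measurable hm, heq, Measure.smul_apply, volume_pi_pi]
  simp_rw [Complex.volume_ball]
  rw [Finset.prod_mul_distrib, Finset.prod_const, Finset.card_univ, Fintype.card_fin,
    ENNReal.ofReal_mul (by positivity), ENNReal.ofReal_mul (by positivity),
    ENNReal.ofReal_prod_of_nonneg (fun j _ => by positivity), ENNReal.ofReal_pow Real.pi_pos.le]
  have hpi : ENNReal.ofReal Real.pi = NNReal.pi := by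
    rw [← NNReal.coe_real_pi, ENNReal.ofReal_coe_nnreal]
  simp_rw [ENNReal.ofReal_pow (ht _).le]
  rw [hpi, ENNReal.ofReal_coe_nnreal, ENNReal.smul_def, smul_eq_mul]
  exact le_of_eq (by ring)

/-- The part of a polydisc inside the ball of radius `R`. -/
def ballPolydisc (R : ℝ) (t : Fin n → ℝ) : Set (EuclideanSpace ℂ (Fin n)) :=
  {ζ | ζ ∈ ball 0 R ∧ ∀ j, ‖ζ j‖ < t j}

theorem isOpen_ballPolydisc (R : ℝ) (t : Fin n → ℝ) : IsOpen (ballPolydisc R t) := by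
  have : ballPolydisc R t = ball 0 R ∩ ⋂ j, {ζ : EuclideanSpace ℂ (Fin n) | ‖ζ j‖ < t j} := by
    ext ζ
    simp [ballPolydisc]
  rw [this]
  refine isOpen_ball.inter (isOpen_iInter_of_finite fun j => ?_)
  exact isOpen_lt (by fun_prop) continuous_const

theorem convex_ballPolydisc (R : ℝ) (t : Fin n → ℝ) : Convex ℝ (ballPolydisc R t) := by
  have : ballPolydisc R t = ball 0 R ∩
      ⋂ j, (EuclideanSpace.proj j : EuclideanSpace ℂ (Fin n) →L[ℂ] ℂ) ⁻¹' ball 0 (t j) := by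
    ext ζ
    simp [ballPolydisc]
  rw [this]
  refine (convex_ball _ _).inter (convex_iInter fun j => ?_)
  exact (convex_ball (0 : ℂ) (t j)).linear_preimage
    (((EuclideanSpace.proj j : EuclideanSpace ℂ (Fin n) →L[ℂ] ℂ).restrictScalars ℝ).toLinearMap)

/-- If `ρ` has derivative at least `1/C` in the real direction of `ζ_ν`, then `∫ |ρ|^{-a}` over the
polydisc of radii `t_j` is at most a constant times `t_ν^{-a} ∏ t_j²`. -/
theorem exists_lintegral_ballPolydisc_le (ν : Fin n) {a C : ℝ} (ha0 : 0 ≤ a) (ha : a < 1)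
    (hC : 0 < C) : ∃ M : ℝ, 0 ≤ M ∧ ∀ (R : ℝ) (ρ : EuclideanSpace ℂ (Fin n) → ℝ),
      DifferentiableOn ℝ ρ (ball 0 R) →
      (∀ ζ ∈ ball 0 R, 1 / C ≤ |fderiv ℝ ρ ζ (EuclideanSpace.single ν 1)|) →
      ∀ t : Fin n → ℝ, (∀ j, 0 < t j) →
        ∫⁻ ζ in ballPolydisc R t, ‖ρ ζ‖ₑ ^ (-a) ≤
          ENNReal.ofReal (M * t ν ^ (-a) * ∏ j, t j ^ 2) := by
  classical
  obtain ⟨κ, hκ, hvol⟩ := exists_volume_polydisc_le n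
  have h1a : 0 < 1 - a := by linarith
  set A := C ^ a * (2 + 2 / (1 - a)) with hA
  have hA0 : 0 ≤ A := by positivity
  refine ⟨A * (κ * 4 ^ n) / 2, by positivity, fun R ρ hρ hder t ht => ?_⟩
  set e : EuclideanSpace ℂ (Fin n) := EuclideanSpace.single ν 1 with he
  set D := ballPolydisc R t with hD
  have hDm : MeasurableSet D := (isOpen_ballPolydisc R t).measurableSet
  have hDR : D ⊆ ball 0 R := fun ζ hζ => hζ.1
  have hρm : Measurable (D.piecewise ρ fun _ => 0) :=
    ContinuousOn.measurable_piecewise (hρ.continuousOn.mono hDR) continuousOn_const hDm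
  set F : EuclideanSpace ℂ (Fin n) → ℝ≥0∞ := D.indicator fun ζ => ‖ρ ζ‖ₑ ^ (-a) with hF
  have hFm : Measurable F := by
    have : F = D.indicator fun ζ => ‖D.piecewise ρ (fun _ => 0) ζ‖ₑ ^ (-a) := by
      refine indicator_congr fun ζ hζ => ?_
      rw [piecewise_eq_of_mem _ _ _ hζ]
    rw [this]
    exact (hρm.enorm.pow_const _).indicator hDm
  have hline : ∀ ζ, ∫⁻ s in Ioo (-t ν) (t ν), F (ζ + s • e) ≤
      ENNReal.ofReal (A * t ν ^ (1 - a)) := by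
    intro ζ
    have haff : ∀ s : ℝ, HasDerivAt (fun s : ℝ => ζ + s • e) e s := fun s => by
      simpa using ((hasDerivAt_id s).smul_const e).const_add ζ
    set I : Set ℝ := {s | ζ + s • e ∈ D} with hI
    have hIc : Convex ℝ I := by
      have : I = AffineMap.lineMap (k := ℝ) ζ (ζ + e) ⁻¹' D := by
        ext s
        simp [hI, AffineMap.lineMap_apply, add_comm]
      rw [this]
      exact (convex_ballPolydisc R t).affine_preimage _
    have hexp := expanding_of_le_abs_deriv hIc (g := fun s => ρ (ζ + s • e))
      (g' := fun s => fderiv ℝ ρ (ζ + s • e) e) hC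
      (fun s hs => ((hρ.differentiableAt (isOpen_ball.mem_nhds (hDR hs))).hasFDerivAt).comp_hasDerivAt
        s (haff s))
      (fun s hs => hder _ (hDR hs))
    exact lintegral_enorm_rpow_le_of_expanding ha0 ha (ht ν) hC hexp
  have hD2 : MeasurableSet {ζ : EuclideanSpace ℂ (Fin n) | ∀ j, ‖ζ j‖ < 2 * t j} := by
    rw [ofPred_forall]
    exact MeasurableSet.iInter fun j => (isOpen_lt (by fun_prop) continuous_const).measurableSet
  have hsupp : ∀ ζ, ∀ s ∈ Ioo (-t ν) (t ν), F (ζ + s • e) ≠ 0 →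
      ζ ∈ {ζ : EuclideanSpace ℂ (Fin n) | ∀ j, ‖ζ j‖ < 2 * t j} := by
    intro ζ s hs hne j
    have hmem : ζ + s • e ∈ D := by
      by_contra h
      exact hne (indicator_of_notMem h _)
    have h1 := hmem.2 j
    by_cases hj : j = ν
    · subst hj
      have h2 : ‖(s : ℂ)‖ < t j := by
        rw [Complex.norm_real]
        exact abs_lt.2 hs
      have h3 : ζ j = (ζ + s • e) j - (s : ℂ) := by simp [he]
      rw [h3]
      exact (norm_sub_le _ _).trans_lt (by linarith)
    · have h3 : (ζ + s • e) j = ζ j := by simp [he, hj]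
      rw [h3] at h1
      linarith [ht j]
  have key := lintegral_le_of_lintegral_segment_le (μ := volume) hFm hD2 hline hsupp
  have hv := hvol (fun j => 2 * t j) fun j => by linarith [ht j]
  have h2t : 0 < 2 * t ν := by linarith [ht ν]
  rw [hF, lintegral_indicator hDm] at key
  have hfinal : ENNReal.ofReal (2 * t ν) * ∫⁻ ζ in D, ‖ρ ζ‖ₑ ^ (-a) ≤
      ENNReal.ofReal (2 * t ν) *
        ENNReal.ofReal (A * (κ * 4 ^ n) / 2 * t ν ^ (-a) * ∏ j, t j ^ 2) := by
    refine key.trans ((mul_le_mul_right hv _).trans (le_of_eq ?_))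
    have htν := ht ν
    rw [← ENNReal.ofReal_mul (by positivity), ← ENNReal.ofReal_mul h2t.le]
    congr 1
    simp_rw [mul_pow]
    rw [Finset.prod_mul_distrib, Finset.prod_const, Finset.card_univ, Fintype.card_fin,
      sub_eq_add_neg 1 a, Real.rpow_add htν, Real.rpow_one]
    ring
  exact (ENNReal.mul_le_mul_iff_right (by simpa using h2t) ENNReal.ofReal_ne_top).1 hfinal

/-- The integral of `|r|^{-a}` over the image of a polydisc under the coordinates of a `𝓑`-system,
with a constant uniform in the base point and the scale. -/
theorem BSystem.exists_lintegral_image_ballPolydisc_le {Ω : Set (EuclideanSpace ℂ (Fin n))}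
    {r : EuclideanSpace ℂ (Fin n) → ℝ} (hr : ContDiff ℝ ∞ r) {p : EuclideanSpace ℂ (Fin n)}
    (B : BSystem Ω r p) {a : ℝ} (ha0 : 0 ≤ a) (ha : a < 1) :
    ∃ M : ℝ, 0 ≤ M ∧ ∀ z ∈ B.U ∩ Ω, ∀ δ ∈ Ioc 0 B.δ₀, ∀ t : Fin n → ℝ, (∀ j, 0 < t j) →
      ∫⁻ w in B.Ψ z δ '' ballPolydisc B.R t, ‖r w‖ₑ ^ (-a) ≤
        ENNReal.ofReal (M * t B.ν ^ (-a) * ∏ j, t j ^ 2) := by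
  have hC : 0 < B.C := one_pos.trans_le B.one_le_C
  obtain ⟨M, hM0, hM⟩ := exists_lintegral_ballPolydisc_le B.ν ha0 ha hC
  set d := Module.finrank ℝ (EuclideanSpace ℂ (Fin n)) with hd
  refine ⟨B.C ^ d * M, by positivity, fun z hz δ hδ t ht => ?_⟩
  have hLip : LipschitzOnWith (Real.toNNReal B.C) (B.Ψ z δ) (ball 0 B.R) :=
    LipschitzOnWith.of_dist_le_mul fun ζ hζ ξ hξ => by
      rw [Real.coe_toNNReal _ hC.le]
      exact (B.Ψ_biLipschitz z hz δ hδ ζ hζ ξ hξ).1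
  have hdiff : DifferentiableOn ℝ (fun ξ => r (B.Ψ z δ ξ)) (ball 0 B.R) :=
    (hr.differentiable (by simp)).comp_differentiableOn
      ((B.Ψ_holomorphic z hz δ hδ).restrictScalars ℝ)
  have htν := ht B.ν
  calc ∫⁻ w in B.Ψ z δ '' ballPolydisc B.R t, ‖r w‖ₑ ^ (-a)
      ≤ (Real.toNNReal B.C : ℝ≥0∞) ^ d *
        ∫⁻ ζ in ballPolydisc B.R t, ‖r (B.Ψ z δ ζ)‖ₑ ^ (-a) :=
        lintegral_image_le_of_lipschitzOnWith volume (isOpen_ballPolydisc _ _).measurableSet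
          (hLip.mono fun ζ hζ => hζ.1) (hr.continuous.measurable.enorm.pow_const _)
    _ ≤ (Real.toNNReal B.C : ℝ≥0∞) ^ d *
        ENNReal.ofReal (M * t B.ν ^ (-a) * ∏ j, t j ^ 2) := by
        gcongr
        exact hM B.R _ hdiff (B.transverse z hz δ hδ) t ht
    _ = _ := by
        rw [show (Real.toNNReal B.C : ℝ≥0∞) = ENNReal.ofReal B.C from rfl,
          ← ENNReal.ofReal_pow hC.le, ← ENNReal.ofReal_mul (by positivity)]
        congr 1
        ring

end Polydisc

/-! ### Kernel integrals near a boundary point -/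

section Local

variable {n : ℕ} {Ω : Set (EuclideanSpace ℂ (Fin n))} {r : EuclideanSpace ℂ (Fin n) → ℝ}
  {p : EuclideanSpace ℂ (Fin n)}

theorem BSystem.prod_b_pos (B : BSystem Ω r p) {z : EuclideanSpace ℂ (Fin n)}
    (hz : z ∈ B.U ∩ Ω) {δ : ℝ} (hδ : δ ∈ Ioc 0 B.δ₀) : 0 < ∏ j, B.b j z δ ^ 2 :=
  Finset.prod_pos fun j _ => pow_pos (B.b_pos z hz δ hδ j) 2

/-- Doubling of the reciprocal volumes of the polydiscs. -/
theorem BSystem.prod_b_le_two_mul (B : BSystem Ω r p) {z : EuclideanSpace ℂ (Fin n)}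
    (hz : z ∈ B.U ∩ Ω) {δ : ℝ} (hδ : 0 < δ) (hδ' : 2 * δ ≤ B.δ₀) :
    ∏ j, B.b j z δ ^ 2 ≤ (4 * B.C ^ 2) ^ n * ∏ j, B.b j z (2 * δ) ^ 2 := by
  have h1 : δ ∈ Ioc 0 B.δ₀ := ⟨hδ, by linarith⟩
  have h2 : 2 * δ ∈ Ioc 0 B.δ₀ := ⟨by linarith, hδ'⟩
  have hC := B.one_le_C
  have hj : ∀ j, B.b j z δ ^ 2 ≤ 4 * B.C ^ 2 * B.b j z (2 * δ) ^ 2 := by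
    intro j
    have hC2 : 1 ≤ B.C ^ 2 := one_le_pow₀ hC
    by_cases h : j = B.ν
    · rw [h, B.b_normal z hz δ h1, B.b_normal z hz _ h2]
      have : (1 / δ) ^ 2 = 4 * 1 * (1 / (2 * δ)) ^ 2 := by
        field_simp
        norm_num
      rw [this]
      gcongr
    · have h3 := B.b_scale z hz _ h2 δ ⟨hδ, by linarith⟩ j h
      have h4 : (2 * δ / δ) = 2 := by field_simp
      rw [h4] at h3
      calc B.b j z δ ^ 2 ≤ (B.C * √2 * B.b j z (2 * δ)) ^ 2 :=
            pow_le_pow_left₀ (B.b_pos z hz δ h1 j).le h3 2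
        _ = 2 * B.C ^ 2 * B.b j z (2 * δ) ^ 2 := by
            rw [mul_pow, mul_pow, Real.sq_sqrt (by norm_num)]
            ring
        _ ≤ 4 * B.C ^ 2 * B.b j z (2 * δ) ^ 2 := by
            gcongr
            norm_num
  calc ∏ j, B.b j z δ ^ 2 ≤ ∏ j, (4 * B.C ^ 2 * B.b j z (2 * δ) ^ 2) :=
        Finset.prod_le_prod (fun j _ => by positivity) fun j _ => hj j
    _ = _ := by
        rw [Finset.prod_mul_distrib, Finset.prod_const, Finset.card_univ, Fintype.card_fin]

/-- At scales comparable to `δ₀` the kernel bound is a constant. -/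
theorem BSystem.prod_b_le_of_half_le (B : BSystem Ω r p) {z : EuclideanSpace ℂ (Fin n)}
    (hz : z ∈ B.U ∩ Ω) {δ : ℝ} (hδ : δ ∈ Ioc 0 B.δ₀) (hδ' : B.δ₀ / 2 ≤ δ) :
    ∏ j, B.b j z δ ^ 2 ≤ ((1 / (B.δ₀ / 2) + B.C / √(B.δ₀ / 2)) ^ 2) ^ n := by
  have h0 : 0 < B.δ₀ / 2 := half_pos B.δ₀_pos
  have hC : 0 < B.C := one_pos.trans_le B.one_le_C
  have hj : ∀ j, B.b j z δ ≤ 1 / (B.δ₀ / 2) + B.C / √(B.δ₀ / 2) := by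
    intro j
    by_cases h : j = B.ν
    · rw [h, B.b_normal z hz δ hδ]
      have : 1 / δ ≤ 1 / (B.δ₀ / 2) := by gcongr
      have h2 : 0 ≤ B.C / √(B.δ₀ / 2) := by positivity
      linarith
    · have h1 := B.b_le z hz δ hδ j h
      have : B.C / √δ ≤ B.C / √(B.δ₀ / 2) := by gcongr
      have h2 : 0 ≤ 1 / (B.δ₀ / 2) := by positivity
      linarith
  calc ∏ j, B.b j z δ ^ 2 ≤ ∏ _j : Fin n, (1 / (B.δ₀ / 2) + B.C / √(B.δ₀ / 2)) ^ 2 :=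
        Finset.prod_le_prod (fun j _ => by positivity) fun j _ =>
          pow_le_pow_left₀ (B.b_pos z hz δ hδ j).le (hj j) 2
    _ = _ := by rw [Finset.prod_const, Finset.card_univ, Fintype.card_fin]

/-- `|r|^{-a}` is integrable near a boundary point. -/
theorem BSystem.lintegral_U_lt_top (hr : ContDiff ℝ ∞ r) (B : BSystem Ω r p) {a : ℝ} (ha0 : 0 ≤ a)
    (ha : a < 1) : ∫⁻ w in B.U ∩ Ω, ‖r w‖ₑ ^ (-a) < ⊤ := by
  rcases (B.U ∩ Ω).eq_empty_or_nonempty with h | ⟨z, hz⟩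
  · simp [h]
  obtain ⟨M, -, hM⟩ := B.exists_lintegral_image_ballPolydisc_le hr ha0 ha
  have hδ : B.δ₀ ∈ Ioc 0 B.δ₀ := ⟨B.δ₀_pos, le_rfl⟩
  refine lt_of_le_of_lt (lintegral_mono_set ?_)
    ((hM z hz B.δ₀ hδ (fun _ => B.R) fun _ => B.R_pos).trans_lt ENNReal.ofReal_lt_top)
  intro w hw
  obtain ⟨ζ, hζ, rfl⟩ := B.Ψ_cover z hz B.δ₀ hδ hw.1
  refine ⟨ζ, ⟨hζ, fun j => ?_⟩, rfl⟩
  exact (PiLp.norm_apply_le ζ j).trans_lt (mem_ball_zero_iff.1 hζ)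

/-- Splitting a set along a sequence of sets `Q k`. -/
theorem lintegral_le_sum_diff {X : Type*} [MeasurableSpace X] (μ : Measure X) (G : X → ℝ≥0∞)
    (S : Set X) (Q : ℕ → Set X) (N : ℕ) :
    ∫⁻ w in S, G w ∂μ ≤ (∫⁻ w in S ∩ Q 0, G w ∂μ) +
      (∑ k ∈ Finset.range N, ∫⁻ w in (S ∩ Q (k + 1)) \ Q k, G w ∂μ) +
      ∫⁻ w in S \ Q N, G w ∂μ := by
  induction N with
  | zero =>
    rw [Finset.range_zero, Finset.sum_empty, add_zero]
    refine le_trans (le_of_eq ?_) (lintegral_union_le _ _ _)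
    rw [inter_union_sdiff]
  | succ N ih =>
    refine ih.trans ?_
    rw [Finset.sum_range_succ, ← add_assoc, add_assoc _ _ (∫⁻ w in S \ Q (N + 1), G w ∂μ)]
    gcongr
    refine le_trans (lintegral_mono_set ?_) (lintegral_union_le _ _ _)
    rintro w ⟨hw, hwN⟩
    by_cases h : w ∈ Q (N + 1)
    · exact Or.inl ⟨⟨hw, h⟩, hwN⟩
    · exact Or.inr ⟨hw, h⟩

/-- The main estimate: the kernel integral of `|r|^{-a}` near a boundary point is bounded by
`|r(z)|^{-a}`. The neighbourhood is cut into the polydisc of scale `|r(z)|`, the dyadic shells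
of scales `2^k |r(z)|` and the rest; the shells contribute a geometric series because the kernel
bound is the reciprocal of the volume of the polydisc of the same scale. -/
theorem BSystem.exists_lintegral_kernel_le (hr : ContDiff ℝ ∞ r) (hneg : ∀ z ∈ Ω, r z < 0)
    (B : BSystem Ω r p) (hB : B.UpperEstimate) {a : ℝ} (ha0 : 0 < a) (ha : a < 1) :
    ∃ M : ℝ, ∀ z ∈ B.U ∩ Ω, |r z| ≤ B.δ₀ →
      ∫⁻ w in B.U ∩ Ω, ‖bergmanKernel Ω z w‖ₑ * ‖r w‖ₑ ^ (-a) ≤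
        ENNReal.ofReal (M * |r z| ^ (-a)) := by
  obtain ⟨A', hA'⟩ := hB
  -- A nonnegative constant in the size estimate.
  set A := max A' 0 with hAdef
  have hA0 : 0 ≤ A := le_max_right _ _
  have hA : ∀ z ∈ B.U ∩ Ω, ∀ w ∈ B.U ∩ Ω, ∀ δ ∈ Ioc 0 B.δ₀,
      (δ ≤ |r z| + |r w| ∨ w ∉ B.polydisc z δ) →
        ‖bergmanKernel Ω z w‖ₑ ≤ ENNReal.ofReal (A * ∏ j, B.b j z δ ^ 2) := by
    intro z hz w hw δ hδ h
    rw [← ofReal_norm]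
    refine ENNReal.ofReal_le_ofReal ((hA' z hz w hw δ hδ h).trans ?_)
    exact mul_le_mul_of_nonneg_right (le_max_left _ _) (B.prod_b_pos hz hδ).le
  obtain ⟨M, hM0, hM⟩ := B.exists_lintegral_image_ballPolydisc_le hr ha0.le ha
  have hW := B.lintegral_U_lt_top hr ha0.le ha
  set W := (∫⁻ w in B.U ∩ Ω, ‖r w‖ₑ ^ (-a)).toReal with hWdef
  set β := ((1 / (B.δ₀ / 2) + B.C / √(B.δ₀ / 2)) ^ 2) ^ n with hβ
  have hβ0 : 0 ≤ β := by positivity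
  have hW0 : 0 ≤ W := ENNReal.toReal_nonneg
  set θ : ℝ := 2 ^ (-a) with hθ
  have hθ0 : 0 < θ := by positivity
  have hθ1 : θ < 1 := Real.rpow_lt_one_of_one_lt_of_neg one_lt_two (by linarith)
  have hδ₀ := B.δ₀_pos
  set L := (4 * B.C ^ 2) ^ n with hL
  have hL0 : 0 ≤ L := by positivity
  refine ⟨A * M + A * M * L * (1 - θ)⁻¹ + A * β * W * B.δ₀ ^ a, fun z hz hzδ => ?_⟩
  set ρ := |r z| with hρdef
  have hρ : 0 < ρ := abs_pos.2 (hneg z hz.2).ne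
  obtain ⟨N, hN1, hN2⟩ := exists_nat_pow_near (x := B.δ₀ / ρ) (y := (2 : ℝ))
    ((one_le_div hρ).2 hzδ) one_lt_two
  rw [le_div_iff₀ hρ] at hN1
  rw [div_lt_iff₀ hρ] at hN2
  have hscale : ∀ k ≤ N, (2 : ℝ) ^ k * ρ ∈ Ioc 0 B.δ₀ := fun k hk =>
    ⟨by positivity, le_trans (by gcongr; norm_num) hN1⟩
  set S := B.U ∩ Ω with hS
  set G := fun w => ‖bergmanKernel Ω z w‖ₑ * ‖r w‖ₑ ^ (-a) with hG
  set Q : ℕ → Set (EuclideanSpace ℂ (Fin n)) := fun k => B.polydisc z (2 ^ k * ρ) with hQ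
  have hrm : Measurable fun w => ‖r w‖ₑ ^ (-a) := hr.continuous.measurable.enorm.pow_const _
  -- A uniform bound `c` for the kernel on a piece `T` gives a bound for the integral over it.
  have hpiece : ∀ (T : Set (EuclideanSpace ℂ (Fin n))) (c : ℝ),
      (∀ w ∈ T, ‖bergmanKernel Ω z w‖ₑ ≤ ENNReal.ofReal c) →
      ∫⁻ w in T, G w ≤ ENNReal.ofReal c * ∫⁻ w in T, ‖r w‖ₑ ^ (-a) := by
    intro T c hc
    rw [← lintegral_const_mul _ hrm]
    refine setLIntegral_mono (hrm.const_mul _) fun w hw => ?_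
    exact mul_le_mul_left (hc w hw) _
  have hpoly : ∀ k ≤ N, ∫⁻ w in Q k, ‖r w‖ₑ ^ (-a) ≤
      ENNReal.ofReal (M * (2 ^ k * ρ) ^ (-a) * (∏ j, B.b j z (2 ^ k * ρ) ^ 2)⁻¹) := by
    intro k hk
    have h := hM z hz _ (hscale k hk) (fun j => 1 / B.b j z (2 ^ k * ρ)) fun j =>
      one_div_pos.2 (B.b_pos z hz _ (hscale k hk) j)
    rw [B.b_normal z hz _ (hscale k hk), one_div_one_div] at h
    have hprod : ∏ j, (1 / B.b j z (2 ^ k * ρ)) ^ 2 = (∏ j, B.b j z (2 ^ k * ρ) ^ 2)⁻¹ := by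
      simp_rw [one_div, inv_pow]
      rw [Finset.prod_inv_distrib]
    rw [hprod] at h
    exact h
  have h0 : ∫⁻ w in S ∩ Q 0, G w ≤ ENNReal.ofReal (A * M * ρ ^ (-a)) := by
    have hs := hscale 0 (Nat.zero_le _)
    have hb := B.prod_b_pos hz hs
    refine (hpiece _ (A * ∏ j, B.b j z (2 ^ 0 * ρ) ^ 2) fun w hw =>
      hA z hz w hw.1 _ hs (Or.inl ?_)).trans ?_
    · rw [pow_zero, one_mul]
      exact le_add_of_nonneg_right (abs_nonneg _)
    · refine (mul_le_mul_right ((lintegral_mono_set inter_subset_right).trans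
        (hpoly 0 (Nat.zero_le _))) _).trans (le_of_eq ?_)
      rw [← ENNReal.ofReal_mul (by positivity)]
      congr 1
      simp only [pow_zero, one_mul] at hb ⊢
      field_simp
  have hk : ∀ k ∈ Finset.range N, ∫⁻ w in (S ∩ Q (k + 1)) \ Q k, G w ≤
      ENNReal.ofReal (A * M * L * ρ ^ (-a) * θ ^ k) := by
    intro k hkN
    have hkN' : k + 1 ≤ N := Finset.mem_range.1 hkN
    have hs := hscale k (by omega)
    have hs' := hscale (k + 1) hkN'
    have hb' := B.prod_b_pos hz hs'
    refine (hpiece _ (A * ∏ j, B.b j z (2 ^ k * ρ) ^ 2) fun w hw =>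
      hA z hz w hw.1.1 _ hs (Or.inr hw.2)).trans ?_
    refine (mul_le_mul_right ((lintegral_mono_set
      (sdiff_subset.trans inter_subset_right)).trans (hpoly (k + 1) hkN')) _).trans ?_
    have hb := B.prod_b_pos hz hs
    rw [← ENNReal.ofReal_mul (by positivity)]
    refine ENNReal.ofReal_le_ofReal ?_
    have e : (2 : ℝ) ^ (k + 1) * ρ = 2 * (2 ^ k * ρ) := by ring
    have hdouble := B.prod_b_le_two_mul hz hs.1 (e ▸ hs'.2)
    rw [← e] at hdouble
    have hpow : ((2 : ℝ) ^ (k + 1) * ρ) ^ (-a) = θ ^ (k + 1) * ρ ^ (-a) := by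
      rw [Real.mul_rpow (by positivity) hρ.le, hθ, ← Real.rpow_natCast, ← Real.rpow_mul zero_le_two,
        ← Real.rpow_natCast, ← Real.rpow_mul zero_le_two, mul_comm (-a)]
    rw [hpow]
    calc A * (∏ j, B.b j z (2 ^ k * ρ) ^ 2) *
          (M * (θ ^ (k + 1) * ρ ^ (-a)) * (∏ j, B.b j z (2 ^ (k + 1) * ρ) ^ 2)⁻¹)
        ≤ A * (L * ∏ j, B.b j z (2 ^ (k + 1) * ρ) ^ 2) *
          (M * (θ ^ k * ρ ^ (-a)) * (∏ j, B.b j z (2 ^ (k + 1) * ρ) ^ 2)⁻¹) := by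
          gcongr A * ?_ * (M * (?_ * _) * _)
          exact pow_le_pow_of_le_one hθ0.le hθ1.le (Nat.le_succ k)
      _ = A * M * L * ρ ^ (-a) * θ ^ k := by
          field_simp
  have hlast : ∫⁻ w in S \ Q N, G w ≤ ENNReal.ofReal (A * β * W * B.δ₀ ^ a * ρ ^ (-a)) := by
    have hs := hscale N le_rfl
    have hb := B.prod_b_le_of_half_le hz hs (by rw [pow_succ] at hN2; linarith)
    refine (hpiece _ (A * β) fun w hw =>
      (hA z hz w hw.1 _ hs (Or.inr hw.2)).trans (ENNReal.ofReal_le_ofReal (by gcongr))).trans ?_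
    refine (mul_le_mul_right (lintegral_mono_set sdiff_subset) _).trans ?_
    rw [← ENNReal.ofReal_toReal hW.ne, ← ENNReal.ofReal_mul (by positivity)]
    refine ENNReal.ofReal_le_ofReal ?_
    have h1 : 1 ≤ B.δ₀ ^ a * ρ ^ (-a) := by
      rw [Real.rpow_neg hρ.le, ← div_eq_mul_inv, ← Real.div_rpow hδ₀.le hρ.le]
      exact Real.one_le_rpow ((one_le_div hρ).2 hzδ) ha0.le
    calc A * β * W = A * β * W * 1 := (mul_one _).symm
      _ ≤ A * β * W * (B.δ₀ ^ a * ρ ^ (-a)) := by gcongr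
      _ = _ := by ring
  have hgeom : ∑ k ∈ Finset.range N, θ ^ k ≤ (1 - θ)⁻¹ := by
    rw [← tsum_geometric_of_lt_one hθ0.le hθ1]
    exact (summable_geometric_of_lt_one hθ0.le hθ1).sum_le_tsum _ fun k _ => by positivity
  calc ∫⁻ w in S, G w
      ≤ (∫⁻ w in S ∩ Q 0, G w) +
        (∑ k ∈ Finset.range N, ∫⁻ w in (S ∩ Q (k + 1)) \ Q k, G w) +
        ∫⁻ w in S \ Q N, G w := lintegral_le_sum_diff _ _ _ _ _
    _ ≤ ENNReal.ofReal (A * M * ρ ^ (-a)) +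
        (∑ k ∈ Finset.range N, ENNReal.ofReal (A * M * L * ρ ^ (-a) * θ ^ k)) +
        ENNReal.ofReal (A * β * W * B.δ₀ ^ a * ρ ^ (-a)) := by
        gcongr with k hkN
        exact hk k hkN
    _ = ENNReal.ofReal (A * M * ρ ^ (-a) +
        (A * M * L * ρ ^ (-a) * ∑ k ∈ Finset.range N, θ ^ k) +
        A * β * W * B.δ₀ ^ a * ρ ^ (-a)) := by
        have hsum : 0 ≤ ∑ k ∈ Finset.range N, θ ^ k := Finset.sum_nonneg fun k _ => by positivity
        rw [← ENNReal.ofReal_sum_of_nonneg (fun k _ => by positivity), ← Finset.mul_sum,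
          ← ENNReal.ofReal_add (by positivity) (by positivity),
          ← ENNReal.ofReal_add (by positivity) (by positivity)]
    _ ≤ _ := by
        refine ENNReal.ofReal_le_ofReal ?_
        calc A * M * ρ ^ (-a) + (A * M * L * ρ ^ (-a) * ∑ k ∈ Finset.range N, θ ^ k) +
              A * β * W * B.δ₀ ^ a * ρ ^ (-a)
            ≤ A * M * ρ ^ (-a) + (A * M * L * ρ ^ (-a) * (1 - θ)⁻¹) +
              A * β * W * B.δ₀ ^ a * ρ ^ (-a) := by gcongr
          _ = _ := by ring

end Local

/-! ### Global estimates on a bounded domain with kernel of sharp `𝓑`-type -/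

section Global

variable {n : ℕ} {Ω : Set (EuclideanSpace ℂ (Fin n))} {r : EuclideanSpace ℂ (Fin n) → ℝ}

theorem IsDefiningFunction.neg (hr : IsDefiningFunction Ω r) {z : EuclideanSpace ℂ (Fin n)}
    (hz : z ∈ Ω) : r z < 0 := by
  rw [hr.2.1] at hz
  exact hz

theorem IsDefiningFunction.isOpen (hr : IsDefiningFunction Ω r) : IsOpen Ω := by
  rw [hr.2.1]
  exact isOpen_lt hr.1.continuous continuous_const

theorem IsDefiningFunction.eq_zero (hr : IsDefiningFunction Ω r) {p : EuclideanSpace ℂ (Fin n)}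
    (hp : p ∈ frontier Ω) : r p = 0 := by
  have h1 : p ∈ closure {z | r z < 0} := hr.2.1 ▸ frontier_subset_closure hp
  have h2 : r p ≤ 0 := closure_lt_subset_le hr.1.continuous continuous_const h1
  have h3 : p ∉ Ω := by
    rw [frontier, hr.isOpen.interior_eq] at hp
    exact hp.2
  refine le_antisymm h2 ?_
  by_contra! h
  exact h3 (by rw [hr.2.1]; exact h)

/-- Locally uniform bounds on a set with compact closure are uniform. -/
theorem exists_bound_of_locally {X : Type*} [TopologicalSpace X] {S : Set X}
    (hS : IsCompact (closure S)) {P : X → ℝ → Prop}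
    (hmono : ∀ z M M', M ≤ M' → P z M → P z M')
    (hloc : ∀ p ∈ closure S, ∃ V ∈ nhds p, ∃ M, ∀ z ∈ V ∩ S, P z M) : ∃ M, ∀ z ∈ S, P z M := by
  have h := hS.induction_on (p := fun V => ∃ M, ∀ z ∈ V ∩ S, P z M)
    ⟨0, fun z hz => hz.1.elim⟩
    (fun s t hst ⟨M, hM⟩ => ⟨M, fun z hz => hM z ⟨hst hz.1, hz.2⟩⟩)
    (fun s t ⟨M, hM⟩ ⟨M', hM'⟩ => ⟨max M M', fun z hz => hz.1.elim
      (fun h => hmono _ _ _ (le_max_left _ _) (hM z ⟨h, hz.2⟩))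
      fun h => hmono _ _ _ (le_max_right _ _) (hM' z ⟨h, hz.2⟩)⟩)
    (fun p hp => by
      obtain ⟨V, hV, h⟩ := hloc p hp
      exact ⟨V, mem_nhdsWithin_of_mem_nhds hV, h⟩)
  obtain ⟨M, hM⟩ := h
  exact ⟨M, fun z hz => hM z ⟨subset_closure hz, hz⟩⟩

/-- The Bergman kernel exists: near a boundary point this is forced by the lower estimate, the
kernel being zero by convention otherwise; a bounded domain without boundary is a point. -/
theorem exists_isBergmanKernel_of_sharp (hdom : IsDomainSet Ω) (hbdd : Bornology.IsBounded Ω)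
    (hr : IsDefiningFunction Ω r)
    (hloc : ∀ p ∈ frontier Ω, ∃ B : BSystem Ω r p, B.LowerEstimate) :
    ∃ K, IsBergmanKernel Ω K := by
  rcases (frontier Ω).eq_empty_or_nonempty with h | ⟨p, hp⟩
  · have hu : Ω = univ := (isClopen_iff_frontier_eq_empty.2 h).eq_univ hdom.2.nonempty
    subst hu
    have hsub : Subsingleton (EuclideanSpace ℂ (Fin n)) := by
      by_contra hns
      rw [not_subsingleton_iff_nontrivial] at hns
      exact NormedSpace.unbounded_univ ℝ (EuclideanSpace ℂ (Fin n)) hbdd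
    have hfin : volume (univ : Set (EuclideanSpace ℂ (Fin n))) ≠ ⊤ :=
      hbdd.measure_lt_top.ne
    have hne : volume (univ : Set (EuclideanSpace ℂ (Fin n))) ≠ 0 :=
      (isOpen_univ.measure_pos volume univ_nonempty).ne'
    have hfm : IsFiniteMeasure (volume : Measure (EuclideanSpace ℂ (Fin n))) := ⟨hfin.lt_top⟩
    have hreal : (volume.real (univ : Set (EuclideanSpace ℂ (Fin n)))) ≠ 0 :=
      (ENNReal.toReal_pos hne hfin).ne'
    refine ⟨fun _ _ => ((volume.real (univ : Set (EuclideanSpace ℂ (Fin n))))⁻¹ : ℝ),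
      fun w _ => ⟨⟨differentiableOn_const _, memLp_const _⟩, fun f _ => ?_⟩⟩
    have hf : ∀ z, f z = f w := fun z => congrArg f (Subsingleton.elim z w)
    simp_rw [hf]
    rw [Measure.restrict_univ, integral_const, Complex.conj_ofReal, Complex.real_smul]
    have hne' := Complex.ofReal_ne_zero.2 hreal
    push_cast
    field_simp
  · obtain ⟨B, c, hc, hB⟩ := hloc p hp
    have hV : B.U ∩ {z | |r z| < B.δ₀} ∈ nhds p := by
      refine (B.isOpen_U.inter (isOpen_lt hr.1.continuous.abs continuous_const)).mem_nhds
        ⟨B.mem_U, ?_⟩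
      simp [hr.eq_zero hp, B.δ₀_pos]
    obtain ⟨z, ⟨hzU, hzr⟩, hz⟩ :=
      mem_closure_iff_nhds.1 (frontier_subset_closure hp) _ hV
    have hzr' : |r z| < B.δ₀ := hzr
    have h1 := hB z ⟨hzU, hz⟩ hzr'.le
    have h2 := B.prod_b_pos ⟨hzU, hz⟩ (δ := |r z|) ⟨abs_pos.2 (hr.neg hz).ne, hzr'.le⟩
    by_contra hno
    have h3 : bergmanKernel Ω z z = 0 := by
      unfold bergmanKernel
      rw [dif_neg hno]
      rfl
    rw [h3, norm_zero] at h1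
    exact absurd h1 (not_le.2 (by positivity))

/-- Away from the boundary, the kernel is bounded. -/
theorem exists_kernel_bound_near_interior (hr : IsDefiningFunction Ω r)
    (haway : ∀ ε : ℝ, 0 < ε → ∃ A : ℝ, ∀ z ∈ Ω, ∀ w ∈ Ω, ε ≤ dist z w + |r z| →
      ‖bergmanKernel Ω z w‖ ≤ A) {p : EuclideanSpace ℂ (Fin n)} (hp : p ∈ Ω) :
    ∃ V ∈ nhds p, ∃ A, 0 ≤ A ∧ ∀ z ∈ V ∩ Ω, ∀ w ∈ Ω, ‖bergmanKernel Ω z w‖ ≤ A := by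
  have hp0 : 0 < |r p| := abs_pos.2 (hr.neg hp).ne
  obtain ⟨A, hA⟩ := haway (|r p| / 2) (half_pos hp0)
  refine ⟨{z | |r p| / 2 < |r z|}, (isOpen_lt continuous_const hr.1.continuous.abs).mem_nhds
    (half_lt_self hp0), max A 0, le_max_right _ _, fun z hz w hw => ?_⟩
  have h1 : |r p| / 2 < |r z| := hz.1
  refine (hA z hz.2 w hw ?_).trans (le_max_left _ _)
  have := dist_nonneg (x := z) (y := w)
  linarith

/-- Near a boundary point the kernel is bounded off the neighbourhood of a `𝓑`-system. -/
theorem exists_kernel_bound_near_frontier (hr : IsDefiningFunction Ω r)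
    (haway : ∀ ε : ℝ, 0 < ε → ∃ A : ℝ, ∀ z ∈ Ω, ∀ w ∈ Ω, ε ≤ dist z w + |r z| →
      ‖bergmanKernel Ω z w‖ ≤ A) {p : EuclideanSpace ℂ (Fin n)} (hp : p ∈ frontier Ω)
    (B : BSystem Ω r p) :
    ∃ V ∈ nhds p, V ⊆ B.U ∧ (∀ z ∈ V, |r z| ≤ B.δ₀) ∧ ∃ A, 0 ≤ A ∧
      ∀ z ∈ V ∩ Ω, ∀ w ∈ Ω, w ∉ B.U → ‖bergmanKernel Ω z w‖ ≤ A := by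
  obtain ⟨ε, hε, hball⟩ := Metric.isOpen_iff.1 B.isOpen_U p B.mem_U
  obtain ⟨A, hA⟩ := haway (ε / 2) (half_pos hε)
  refine ⟨ball p (ε / 2) ∩ {z | |r z| < B.δ₀}, ?_, ?_, fun z hz => hz.2.le, max A 0,
    le_max_right _ _, fun z hz w hw hwU => ?_⟩
  · refine (isOpen_ball.inter (isOpen_lt hr.1.continuous.abs continuous_const)).mem_nhds
      ⟨mem_ball_self (half_pos hε), ?_⟩
    simp [hr.eq_zero hp, B.δ₀_pos]
  · exact fun z hz => hball (ball_subset_ball (by linarith) hz.1)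
  · refine (hA z hz.2 w hw ?_).trans (le_max_left _ _)
    have h1 : ε ≤ dist w p := by
      by_contra! h
      exact hwU (hball h)
    have h2 : dist z p < ε / 2 := hz.1.1
    have h3 := dist_triangle_left w p z
    have h4 := abs_nonneg (r z)
    linarith

theorem mem_or_mem_frontier (hr : IsDefiningFunction Ω r) {p : EuclideanSpace ℂ (Fin n)}
    (hp : p ∈ closure Ω) : p ∈ Ω ∨ p ∈ frontier Ω := by
  by_cases h : p ∈ Ω
  · exact Or.inl h
  · refine Or.inr ⟨hp, ?_⟩
    rwa [hr.isOpen.interior_eq]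

/-- Property BR in multiplicative form: the size estimate at scale `|r(z)|` and the lower estimate
have the same right-hand side. -/
theorem exists_kernel_le_diag (hbdd : Bornology.IsBounded Ω) (hr : IsDefiningFunction Ω r)
    (haway : ∀ ε : ℝ, 0 < ε → ∃ A : ℝ, ∀ z ∈ Ω, ∀ w ∈ Ω, ε ≤ dist z w + |r z| →
      ‖bergmanKernel Ω z w‖ ≤ A)
    (hloc : ∀ p ∈ frontier Ω, ∃ B : BSystem Ω r p, B.UpperEstimate ∧ B.LowerEstimate)
    (hK : IsBergmanKernel Ω (bergmanKernel Ω)) :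
    ∃ M : ℝ, ∀ z ∈ Ω, ∀ w ∈ Ω, ‖bergmanKernel Ω z w‖ ≤ M * ‖bergmanKernel Ω z z‖ := by
  have hvol : volume Ω ≠ ⊤ := hbdd.measure_lt_top.ne
  have hdiag := fun z (hz : z ∈ Ω) => hK.one_le_diag hvol hz
  set v := (volume Ω).toReal with hv
  have hv0 : 0 ≤ v := ENNReal.toReal_nonneg
  have hbd : ∀ A, 0 ≤ A → ∀ z ∈ Ω, A ≤ A * v * ‖bergmanKernel Ω z z‖ := fun A hA z hz => by
    have := mul_le_mul_of_nonneg_left (hdiag z hz) hA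
    linarith
  refine exists_bound_of_locally hbdd.isCompact_closure
    (P := fun z M => ∀ w ∈ Ω, ‖bergmanKernel Ω z w‖ ≤ M * ‖bergmanKernel Ω z z‖)
    (fun z M M' hM h w hw => (h w hw).trans (by gcongr)) fun p hp => ?_
  rcases mem_or_mem_frontier hr hp with hp | hp
  · obtain ⟨V, hV, A, hA0, hA⟩ := exists_kernel_bound_near_interior hr haway hp
    exact ⟨V, hV, A * v, fun z hz w hw => (hA z hz w hw).trans (hbd A hA0 z hz.2)⟩
  · obtain ⟨B, ⟨A₁, hA₁⟩, c, hc, hlow⟩ := hloc p hp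
    obtain ⟨V, hV, hVU, hVδ, A, hA0, hA⟩ := exists_kernel_bound_near_frontier hr haway hp B
    refine ⟨V, hV, A * v + max A₁ 0 / c, fun z hz w hw => ?_⟩
    have hzU : z ∈ B.U ∩ Ω := ⟨hVU hz.1, hz.2⟩
    have h0 := norm_nonneg (bergmanKernel Ω z z)
    have h1 : 0 ≤ max A₁ 0 / c := by positivity
    rw [add_mul]
    by_cases hwU : w ∈ B.U
    · have hδ : |r z| ∈ Ioc 0 B.δ₀ := ⟨abs_pos.2 (hr.neg hz.2).ne, hVδ z hz.1⟩
      have hb := B.prod_b_pos hzU hδ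
      have hup := hA₁ z hzU w ⟨hwU, hw⟩ _ hδ (Or.inl (le_add_of_nonneg_right (abs_nonneg _)))
      have hlo := hlow z hzU hδ.2
      calc ‖bergmanKernel Ω z w‖ ≤ A₁ * ∏ j, B.b j z |r z| ^ 2 := hup
        _ ≤ max A₁ 0 * ∏ j, B.b j z |r z| ^ 2 := by
            gcongr
            exact le_max_left _ _
        _ = max A₁ 0 / c * (c * ∏ j, B.b j z |r z| ^ 2) := by field_simp
        _ ≤ max A₁ 0 / c * ‖bergmanKernel Ω z z‖ := by gcongr
        _ ≤ _ := le_add_of_nonneg_left (by positivity)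
    · exact ((hA z hz w hw hwU).trans (hbd A hA0 z hz.2)).trans
        (le_add_of_nonneg_right (by positivity))

theorem lintegral_defining_lt_top (hbdd : Bornology.IsBounded Ω) (hr : IsDefiningFunction Ω r)
    (hloc : ∀ p ∈ frontier Ω, Nonempty (BSystem Ω r p)) {a : ℝ} (ha0 : 0 < a) (ha : a < 1) :
    ∫⁻ w in Ω, ‖r w‖ₑ ^ (-a) < ⊤ := by
  have h := hbdd.isCompact_closure.induction_on
    (p := fun V => ∫⁻ w in V ∩ Ω, ‖r w‖ₑ ^ (-a) < ⊤) (by simp)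
    (fun s t hst ht => (lintegral_mono_set (inter_subset_inter_left _ hst)).trans_lt ht)
    (fun s t hs ht => by
      rw [union_inter_distrib_right]
      exact (lintegral_union_le _ _ _).trans_lt (ENNReal.add_lt_top.2 ⟨hs, ht⟩))
    (fun p hp => by
      rcases mem_or_mem_frontier hr hp with hp | hp
      · have hp0 : 0 < |r p| := abs_pos.2 (hr.neg hp).ne
        refine ⟨{z | |r p| / 2 < |r z|}, mem_nhdsWithin_of_mem_nhds
          ((isOpen_lt continuous_const hr.1.continuous.abs).mem_nhds (half_lt_self hp0)), ?_⟩
        have hle : ∫⁻ w in {z | |r p| / 2 < |r z|} ∩ Ω, ‖r w‖ₑ ^ (-a) ≤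
            ∫⁻ w in {z | |r p| / 2 < |r z|} ∩ Ω, ENNReal.ofReal (|r p| / 2) ^ (-a) := by
          refine setLIntegral_mono measurable_const fun w hw => ?_
          rw [ENNReal.rpow_neg, ENNReal.rpow_neg, ENNReal.inv_le_inv]
          refine ENNReal.rpow_le_rpow ?_ ha0.le
          rw [← ofReal_norm]
          exact ENNReal.ofReal_le_ofReal (le_of_lt hw.1)
        refine hle.trans_lt ?_
        rw [setLIntegral_const, ENNReal.ofReal_rpow_of_pos (half_pos hp0)]
        exact ENNReal.mul_lt_top ENNReal.ofReal_lt_top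
          ((measure_mono inter_subset_right).trans_lt hbdd.measure_lt_top)
      · obtain ⟨B⟩ := hloc p hp
        exact ⟨B.U, mem_nhdsWithin_of_mem_nhds (B.isOpen_U.mem_nhds B.mem_U),
          B.lintegral_U_lt_top hr.1 ha0.le ha⟩)
  have hsub : Ω ⊆ closure Ω ∩ Ω := fun w hw => ⟨subset_closure hw, hw⟩
  exact (lintegral_mono_set hsub).trans_lt h

/-- The weight `|r|^{-a}` satisfies the hypothesis of Schur's test. -/
theorem exists_lintegral_kernel_le_global (hbdd : Bornology.IsBounded Ω)
    (hr : IsDefiningFunction Ω r)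
    (haway : ∀ ε : ℝ, 0 < ε → ∃ A : ℝ, ∀ z ∈ Ω, ∀ w ∈ Ω, ε ≤ dist z w + |r z| →
      ‖bergmanKernel Ω z w‖ ≤ A)
    (hloc : ∀ p ∈ frontier Ω, ∃ B : BSystem Ω r p, B.UpperEstimate)
    {a : ℝ} (ha0 : 0 < a) (ha : a < 1) :
    ∃ M : ℝ, ∀ z ∈ Ω, ∫⁻ w in Ω, ‖bergmanKernel Ω z w‖ₑ * ‖r w‖ₑ ^ (-a) ≤
      ENNReal.ofReal (M * |r z| ^ (-a)) := by
  have hW := lintegral_defining_lt_top hbdd hr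
    (fun p hp => (hloc p hp).nonempty) ha0 ha
  set W := (∫⁻ w in Ω, ‖r w‖ₑ ^ (-a)).toReal with hWdef
  have hW0 : 0 ≤ W := ENNReal.toReal_nonneg
  have hrm : Measurable fun w => ‖r w‖ₑ ^ (-a) := hr.1.continuous.measurable.enorm.pow_const _
  obtain ⟨ρ, hρ⟩ := hbdd.isCompact_closure.exists_bound_of_continuousOn hr.1.continuous.continuousOn
  -- `|r|` is bounded on `Ω`, so constants are dominated by multiples of `|r(z)|^{-a}`.
  have hone : ∀ z ∈ Ω, 1 ≤ ρ ^ a * |r z| ^ (-a) := by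
    intro z hz
    have hz0 : 0 < |r z| := abs_pos.2 (hr.neg hz).ne
    have hzρ : |r z| ≤ ρ := hρ z (subset_closure hz)
    rw [Real.rpow_neg hz0.le, ← div_eq_mul_inv, ← Real.div_rpow (hz0.le.trans hzρ) hz0.le]
    exact Real.one_le_rpow ((one_le_div hz0).2 hzρ) ha0.le
  have hfar : ∀ A, 0 ≤ A → ∀ z ∈ Ω, ∀ T ⊆ Ω, (∀ w ∈ T, ‖bergmanKernel Ω z w‖ ≤ A) →
      ∫⁻ w in T, ‖bergmanKernel Ω z w‖ₑ * ‖r w‖ₑ ^ (-a) ≤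
        ENNReal.ofReal (A * W * ρ ^ a * |r z| ^ (-a)) := by
    intro A hA z hz T hT hK
    calc ∫⁻ w in T, ‖bergmanKernel Ω z w‖ₑ * ‖r w‖ₑ ^ (-a)
        ≤ ∫⁻ w in T, ENNReal.ofReal A * ‖r w‖ₑ ^ (-a) := by
          refine setLIntegral_mono (hrm.const_mul _) fun w hw => ?_
          refine mul_le_mul_left ?_ _
          rw [← ofReal_norm]
          exact ENNReal.ofReal_le_ofReal (hK w hw)
      _ = ENNReal.ofReal A * ∫⁻ w in T, ‖r w‖ₑ ^ (-a) := lintegral_const_mul _ hrm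
      _ ≤ ENNReal.ofReal A * ∫⁻ w in Ω, ‖r w‖ₑ ^ (-a) :=
          mul_le_mul_right (lintegral_mono_set hT) _
      _ = ENNReal.ofReal (A * W) := by
          rw [← ENNReal.ofReal_toReal hW.ne, ← ENNReal.ofReal_mul hA]
      _ ≤ _ := by
          refine ENNReal.ofReal_le_ofReal ?_
          calc A * W = A * W * 1 := (mul_one _).symm
            _ ≤ A * W * (ρ ^ a * |r z| ^ (-a)) :=
              mul_le_mul_of_nonneg_left (hone z hz) (by positivity)
            _ = _ := by ring
  refine exists_bound_of_locally hbdd.isCompact_closure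
    (P := fun z M => ∫⁻ w in Ω, ‖bergmanKernel Ω z w‖ₑ * ‖r w‖ₑ ^ (-a) ≤
      ENNReal.ofReal (M * |r z| ^ (-a)))
    (fun z M M' hM h => h.trans (ENNReal.ofReal_le_ofReal (by gcongr))) fun p hp => ?_
  rcases mem_or_mem_frontier hr hp with hp | hp
  · obtain ⟨V, hV, A, hA0, hA⟩ := exists_kernel_bound_near_interior hr haway hp
    exact ⟨V, hV, A * W * ρ ^ a, fun z hz =>
      hfar A hA0 z hz.2 Ω subset_rfl fun w hw => hA z hz w hw⟩
  · obtain ⟨B, hB⟩ := hloc p hp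
    obtain ⟨V, hV, hVU, hVδ, A, hA0, hA⟩ := exists_kernel_bound_near_frontier hr haway hp B
    obtain ⟨M, hM⟩ := B.exists_lintegral_kernel_le hr.1 (fun z hz => hr.neg hz) hB ha0 ha
    refine ⟨V, hV, max M 0 + A * W * ρ ^ a, fun z hz => ?_⟩
    have h1 := hM z ⟨hVU hz.1, hz.2⟩ (hVδ z hz.1)
    have h2 := hfar A hA0 z hz.2 (Ω \ B.U) sdiff_subset fun w hw => hA z hz w hw.1 hw.2
    have hρ0 : 0 ≤ ρ := (abs_nonneg _).trans (hρ z (subset_closure hz.2))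
    calc ∫⁻ w in Ω, ‖bergmanKernel Ω z w‖ₑ * ‖r w‖ₑ ^ (-a)
        ≤ (∫⁻ w in B.U ∩ Ω, ‖bergmanKernel Ω z w‖ₑ * ‖r w‖ₑ ^ (-a)) +
          ∫⁻ w in Ω \ B.U, ‖bergmanKernel Ω z w‖ₑ * ‖r w‖ₑ ^ (-a) := by
          refine le_trans (lintegral_mono_set ?_) (lintegral_union_le _ _ _)
          intro w hw
          by_cases h : w ∈ B.U
          · exact Or.inl ⟨h, hw⟩
          · exact Or.inr ⟨hw, h⟩
      _ ≤ ENNReal.ofReal (max M 0 * |r z| ^ (-a)) +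
          ENNReal.ofReal (A * W * ρ ^ a * |r z| ^ (-a)) := by
          refine add_le_add (h1.trans (ENNReal.ofReal_le_ofReal ?_)) h2
          gcongr
          exact le_max_left _ _
      _ = _ := by
          rw [← ENNReal.ofReal_add (by positivity) (by positivity), add_mul]

/-- The absolute Bergman projection is bounded on `L^p`, by Schur's test with the weight
`|r|^{-1/(pq)}`: its `p`-th and `q`-th powers have exponents `-1/q` and `-1/p` in `(-1, 0)`. -/
theorem posNorm_absKernel_lt_top (hbdd : Bornology.IsBounded Ω) (hr : IsDefiningFunction Ω r)
    (haway : ∀ ε : ℝ, 0 < ε → ∃ A : ℝ, ∀ z ∈ Ω, ∀ w ∈ Ω, ε ≤ dist z w + |r z| →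
      ‖bergmanKernel Ω z w‖ ≤ A)
    (hloc : ∀ p ∈ frontier Ω, ∃ B : BSystem Ω r p, B.UpperEstimate)
    (hex : ∃ K, IsBergmanKernel Ω K) {p : ℝ} (hp : 1 < p) :
    posNorm (volume.restrict Ω) (absKernel Ω) p < ⊤ := by
  have hpq : p.HolderConjugate (p.conjExponent) := Real.HolderConjugate.conjExponent hp
  set q := p.conjExponent with hq
  have hp0 := hpq.pos
  have hq0 := hpq.symm.pos
  have hq1 := hpq.symm.lt
  have hΩ := hr.isOpen.measurableSet
  obtain ⟨M₁, hM₁⟩ := exists_lintegral_kernel_le_global hbdd hr haway hloc (a := 1 / p)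
    (by positivity) ((div_lt_one hp0).2 hp)
  obtain ⟨M₂, hM₂⟩ := exists_lintegral_kernel_le_global hbdd hr haway hloc (a := 1 / q)
    (by positivity) ((div_lt_one hq0).2 hq1)
  have hpow : ∀ a : ℝ, ∀ z ∈ Ω, ENNReal.ofReal (|r z| ^ (-a)) = ‖r z‖ₑ ^ (-a) := fun a z hz => by
    rw [← ENNReal.ofReal_rpow_of_pos (abs_pos.2 (hr.neg hz).ne), ← ofReal_norm, Real.norm_eq_abs]
  have hschur : ∀ (a M : ℝ), (∀ z ∈ Ω, ∫⁻ w in Ω, ‖bergmanKernel Ω z w‖ₑ * ‖r w‖ₑ ^ (-a) ≤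
      ENNReal.ofReal (M * |r z| ^ (-a))) → M ≤ max M₁ (max M₂ 0) → ∀ z ∈ Ω,
      ∫⁻ w in Ω, absKernel Ω z w * ‖r w‖ₑ ^ (-a) ≤
        ENNReal.ofReal (max M₁ (max M₂ 0)) * ‖r z‖ₑ ^ (-a) := by
    intro a M hM hle z hz
    have e : ∫⁻ w in Ω, absKernel Ω z w * ‖r w‖ₑ ^ (-a) =
        ∫⁻ w in Ω, ‖bergmanKernel Ω z w‖ₑ * ‖r w‖ₑ ^ (-a) :=
      setLIntegral_congr_fun hΩ fun w hw => by
        rw [absKernel_of_mem hz hw]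
    rw [e, ← hpow a z hz, ← ENNReal.ofReal_mul (by positivity)]
    exact (hM z hz).trans (ENNReal.ofReal_le_ofReal (by gcongr))
  have hmem : ∀ᵐ z ∂(volume.restrict Ω), z ∈ Ω := ae_restrict_mem hΩ
  have hexp1 : ∀ x : ℝ≥0∞, (x ^ (-(1 / (p * q)))) ^ q = x ^ (-(1 / p)) := fun x => by
    rw [← ENNReal.rpow_mul]
    congr 1
    field_simp
  have hexp2 : ∀ x : ℝ≥0∞, (x ^ (-(1 / (p * q)))) ^ p = x ^ (-(1 / q)) := fun x => by
    rw [← ENNReal.rpow_mul]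
    congr 1
    field_simp
  refine posNorm_lt_top_of_schur (measurable_absKernel hr.isOpen hex) hpq
    (h := fun z => ‖r z‖ₑ ^ (-(1 / (p * q)))) (hr.1.continuous.measurable.enorm.pow_const _) ?_ ?_
    (C := ENNReal.ofReal (max M₁ (max M₂ 0))) ENNReal.ofReal_ne_top ?_ ?_
  · filter_upwards [hmem] with z hz
    rw [← hpow _ z hz, Ne, ENNReal.ofReal_eq_zero, not_le]
    exact Real.rpow_pos_of_pos (abs_pos.2 (hr.neg hz).ne) _
  · filter_upwards [hmem] with z hz
    rw [← hpow _ z hz]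
    exact ENNReal.ofReal_ne_top
  · filter_upwards [hmem] with z hz
    simp_rw [hexp1]
    exact hschur _ M₁ hM₁ (le_max_left _ _) z hz
  · filter_upwards [hmem] with z hz
    simp_rw [hexp2, absKernel_symm hex _ z]
    exact hschur _ M₂ hM₂ ((le_max_left _ _).trans (le_max_right _ _)) z hz

end Global

end

/-! ### Product domains -/

theorem mainTheorem4 {m : ℕ} (n : Fin m → ℕ)
    (Ω : ∀ j : Fin m, Set (EuclideanSpace ℂ (Fin (n j))))
    (hdom : ∀ j, IsDomainSet (Ω j))
    (hbdd : ∀ j, Bornology.IsBounded (Ω j))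
    (hsharp : ∀ j, HasSharpBTypeKernel (Ω j)) :
    PropertyBR (Set.univ.pi Ω) ∧
    ∀ (p : ℝ≥0∞) [Fact (1 ≤ p)], 1 < p → p < ⊤ →
      ∃ (T : Lp ℂ p (volume.restrict (Set.univ.pi Ω)) →L[ℂ]
              Lp ℂ p (volume.restrict (Set.univ.pi Ω)))
        (S : ∀ j, Lp ℂ p (volume.restrict (Ω j)) →L[ℂ] Lp ℂ p (volume.restrict (Ω j))),
        IsAbsBergmanProjection (Set.univ.pi Ω) p T ∧
        (∀ j, IsAbsBergmanProjection (Ω j) p (S j)) ∧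
        ‖T‖ = ∏ j, ‖S j‖ := by
  choose r hr haway hloc using hsharp
  have hopen : ∀ j, IsOpen (Ω j) := fun j => (hdom j).1
  have hex : ∀ j, ∃ K, IsBergmanKernel (Ω j) K := fun j =>
    exists_isBergmanKernel_of_sharp (hdom j) (hbdd j) (hr j) fun q hq =>
      let ⟨B, hB⟩ := hloc j q hq; ⟨B, hB.2⟩
  have hK := fun j => isBergmanKernel_bergmanKernel (hex j)
  have hpi := IsBergmanKernel.pi hopen hK
  have hprod : ∀ z ∈ univ.pi Ω, ∀ w ∈ univ.pi Ω,
      bergmanKernel (univ.pi Ω) z w = ∏ j, bergmanKernel (Ω j) (z j) (w j) := fun z hz w hw =>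
    (isBergmanKernel_bergmanKernel ⟨_, hpi⟩).unique hpi hz hw
  have hne : ∀ j, ∀ z ∈ Ω j, bergmanKernel (Ω j) z z ≠ 0 := fun j z hz h0 => by
    have h1 := (hK j).one_le_diag (hbdd j).measure_lt_top.ne hz
    rw [h0, norm_zero, zero_mul] at h1
    exact absurd h1 (by norm_num)
  refine ⟨⟨fun z hz => ?_, ?_⟩, fun p _ hp1 hp => ?_⟩
  · rw [hprod z hz z hz]
    exact Finset.prod_ne_zero_iff.2 fun j _ => hne j _ (hz j (mem_univ j))
  · choose M hM using fun j =>
      exists_kernel_le_diag (hbdd j) (hr j) (haway j) (hloc j) (hK j)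
    refine ⟨∏ j, M j, ?_⟩
    rintro _ ⟨z, hz, w, hw, rfl⟩
    rw [hprod w hw z hz, hprod z hz z hz, norm_prod, norm_prod, ← Finset.prod_div_distrib]
    refine Finset.prod_le_prod (fun j _ => by positivity) fun j _ => ?_
    have hzj := hz j (mem_univ j)
    have hwj := hw j (mem_univ j)
    rw [div_le_iff₀ (norm_pos_iff.2 (hne j _ hzj)), (hK j).norm_symm hwj hzj]
    exact hM j _ hzj _ hwj
  · have hp1' : 1 < p.toReal := by
      rw [← ENNReal.toReal_one]
      exact (ENNReal.toReal_lt_toReal ENNReal.one_ne_top hp.ne).2 hp1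
    have hp0 : 0 < p.toReal := one_pos.trans hp1'
    have hkm := fun j => measurable_absKernel (hopen j) (hex j)
    have hfin : ∀ j, posNorm (volume.restrict (Ω j)) (absKernel (Ω j)) p.toReal ≠ ⊤ := fun j =>
      (posNorm_absKernel_lt_top (hbdd j) (hr j) (haway j)
        (fun q hq => let ⟨B, hB⟩ := hloc j q hq; ⟨B, hB.1⟩) (hex j) hp1').ne
    have hkK : ∀ j, ∀ᵐ x ∂(volume.restrict (Ω j)), ∀ᵐ y ∂(volume.restrict (Ω j)),
        ‖bergmanKernel (Ω j) x y‖ₑ = absKernel (Ω j) x y := fun j => by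
      filter_upwards [ae_restrict_mem (hopen j).measurableSet] with x hx
      filter_upwards [ae_restrict_mem (hopen j).measurableSet] with y hy
      rw [absKernel_of_mem hx hy]
    have hvol : (volume : Measure (∀ j, EuclideanSpace ℂ (Fin (n j)))).restrict (univ.pi Ω) =
        Measure.pi fun j => volume.restrict (Ω j) := by
      rw [volume_pi, Measure.restrict_pi_pi]
    have hmult := posNorm_pi (fun j => (volume : Measure _).restrict (Ω j))
      (fun j => absKernel (Ω j)) hkm hp0 hfin
    rw [← hvol] at hmult
    have hfinT : posNorm (volume.restrict (univ.pi Ω))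
        (fun x y => ∏ j, absKernel (Ω j) (x j) (y j)) p.toReal ≠ ⊤ := by
      rw [hmult]
      exact ENNReal.prod_ne_top fun j _ => hfin j
    have hmeas : MeasurableSet (univ.pi Ω) :=
      MeasurableSet.univ_pi fun j => (hopen j).measurableSet
    have hkKT : ∀ᵐ x ∂(volume.restrict (univ.pi Ω)), ∀ᵐ y ∂(volume.restrict (univ.pi Ω)),
        ‖bergmanKernel (univ.pi Ω) x y‖ₑ = ∏ j, absKernel (Ω j) (x j) (y j) := by
      filter_upwards [ae_restrict_mem hmeas] with x hx
      filter_upwards [ae_restrict_mem hmeas] with y hy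
      rw [hprod x hx y hy, ← ofReal_norm, norm_prod,
        ENNReal.ofReal_prod_of_nonneg fun j _ => norm_nonneg _]
      refine Finset.prod_congr rfl fun j _ => ?_
      rw [ofReal_norm, absKernel_of_mem (hx j (mem_univ j)) (hy j (mem_univ j))]
    obtain ⟨T, hT⟩ := exists_isAbsIntegralOperator hp.ne (measurable_prodKernel hkm) hkKT hfinT
    choose S hS using fun j => exists_isAbsIntegralOperator hp.ne (hkm j) (hkK j) (hfin j)
    refine ⟨T, S, hT, hS, ?_⟩
    have hTn := enorm_rpow_eq_posNorm hp.ne (measurable_prodKernel hkm) hkKT hfinT hT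
    have hSn := fun j => enorm_rpow_eq_posNorm hp.ne (hkm j) (hkK j) (hfin j) (hS j)
    have hpow : ‖T‖ₑ ^ p.toReal = (∏ j, ‖S j‖ₑ) ^ p.toReal := by
      rw [hTn, hmult, ← ENNReal.prod_rpow_of_nonneg hp0.le]
      exact Finset.prod_congr rfl fun j _ => (hSn j).symm
    have henorm := congrArg ENNReal.toReal (ENNReal.rpow_left_injective hp0.ne' hpow)
    simpa only [ENNReal.toReal_prod, toReal_enorm] using henorm
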